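/- Fix a set $X$ of variables. A (finite) read/write-memory history is $h=(O,\mathsf{PO},\ell)$, where $O$ is a set of $n$ operations, the program order $\mathsf{PO}$ is a strict partial order on $O$ that is a disjoint union of total orders (one per site), and $\ell$ labels each operation as a write $\mathrm{wr}(x,v)$ (return value $\bot$) or a read $\mathrm{rd}(x)\triangleright v$, with $x\in X$, $v\in\mathbb N$. The history is *differentiated* if no two distinct operations write the same value to the same variable and no operation writes the initial value $0$. The specification $S_{\mathsf{RW}}$ is the set of finite sequences of such labels in which every read of $x$ returns the value of the last preceding write to $x$, or $0$ if there is none. For a relation $R$ on $O$ write $R^{\le}(o)=\{o' : o'\mathrel{R}o \text{ or } o'=o\}$. For $A,K\subseteq O$ and an order $R$, say that $(A,R)$ *is explained with the return values of $K$* if the operations of $A$ can be arranged in a sequence (each exactly once) that respects $R$ on $A$, in such a way that replacing the return values of the operations outside $K$ by suitable values yields a sequence of $S_{\mathsf{RW}}$. The history $h$ is * CC (causally consistent) if there is a strict partial order $\mathit{co}\supseteq\mathsf{PO}$ on $O$ such that for every $o\in O$, $(\mathit{co}^{\le}(o),\mathit{co})$ is explained with the return value of $o$; * CM (causal memory) if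 there is a strict partial order $\mathit{co}\supseteq\mathsf{PO}$ such that for every $o\in O$, $(\mathit{co}^{\le}(o),\mathit{co})$ is explained with the return values of $\mathsf{PO}^{\le}(o)$; * CCv (causally convergent) if there are a strict partial order $\mathit{co}\supseteq\mathsf{PO}$ and a strict total order $\mathit{arb}\supseteq\mathit{co}$ on $O$ such that for every $o\in O$, $(\mathit{co}^{\le}(o),\mathit{arb})$ is explained with the return value of $o$. **Theorem.** For each of the three criteria CC, CM and CCv there is an algorithm that, given a differentiated read/write-memory history $h$ with $n$ operations, decides in time $O(n^5)$ whether $h$ satisfies the criterion. Here an algorithm is one fixed random access program over registers and arrays of natural numbers, with addition, truncated subtraction, comparisons and indexed access at unit cost. The input consists of $n$, the kind, the variable (named by a natural number, distinct variables having distinct names) and the value of each operation, and the $n\times n$ zero-one matrix of $\mathsf{PO}$; the bound depends on $n$ only, not on the size of the names and values. -/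

import Mathlib

/-! ### Histories, sequences of a specification, and the three consistency criteria -/

universe u v w

/-- The label `(m, arg, rv)` of an operation: method, input, return value. -/
abbrev OpLabel (M : Type u) (D : Type v) : Type (max u v) := M × D × D

/-- A label whose return value may have been hidden (`none`). -/
abbrev PartialLabel (M : Type u) (D : Type v) : Type (max u v) := M × D × Option D

/-- A history `(O, PO, ℓ)`. The program order is a union of total orders, one for each site:
it is a strict partial order for which "equal or comparable" (that is, "submitted to the same
site") is an equivalence relation. -/
structure History (O : Type u) (M : Type v) (D : Type w) where
  po : O → O → Prop
  po_strict : IsStrictOrder O po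
  po_sites : Equivalence fun a b => a = b ∨ po a b ∨ po b a
  label : O → OpLabel M D

/-- A specification: a set of sequences of labels. -/
abbrev Specification (M : Type u) (D : Type v) : Type (max u v) := Set (List (OpLabel M D))

/-- The elements equal to `o` or `R`-below `o`. For a causal order this is the causal past of `o`,
for the program order it is the set of operations of the site of `o` up to and including `o`. -/
def pastOf {O : Type u} (R : O → O → Prop) (o : O) : Set O := {o' | R o' o ∨ o' = o}

open Classical in
/-- The labelling of `h` in which only the return values of the operations in `K` are kept. -/
noncomputable def History.keepRv {O : Type u} {M : Type v} {D : Type w} (h : History O M D)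
    (K : Set O) (o : O) : PartialLabel M D :=
  ((h.label o).1, (h.label o).2.1, if o ∈ K then some (h.label o).2.2 else none)

/-- The full label `l` refines the partial label `p`: it has the same method and input, and the
same return value unless that of `p` is hidden. -/
def LabelRefines {M : Type u} {D : Type v} (p : PartialLabel M D) (l : OpLabel M D) : Prop :=
  p.1 = l.1 ∧ p.2.1 = l.2.1 ∧ ∀ rv, p.2.2 = some rv → rv = l.2.2

/-- `(A, R, ℓ) ≼ ρ`: the labelled sequence `ρ`, a list of operations with their labels, is a
sequence of exactly the operations in `A`, its order contains the restriction of `R` to `A`, and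
its labels refine those given by `ℓ`. -/
def SequencedBy {O : Type u} {M : Type v} {D : Type w} (A : Set O) (R : O → O → Prop)
    (ℓ : O → PartialLabel M D) (ρ : List (O × OpLabel M D)) : Prop :=
  (ρ.map Prod.fst).Nodup ∧
  (∀ a, a ∈ ρ.map Prod.fst ↔ a ∈ A) ∧
  (∀ a ∈ A, ∀ b ∈ A, R a b → List.Sublist [a, b] (ρ.map Prod.fst)) ∧
  ∀ p ∈ ρ, LabelRefines (ℓ p.1) p.2

/-- Causal consistency. -/
def History.IsCC {O : Type u} {M : Type v} {D : Type w} (h : History O M D)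
    (S : Specification M D) : Prop :=
  ∃ co : O → O → Prop, IsStrictOrder O co ∧ (∀ a b, h.po a b → co a b) ∧
    ∀ o, ∃ ρ : List (O × OpLabel M D), ρ.map Prod.snd ∈ S ∧
      SequencedBy (pastOf co o) co (h.keepRv {o}) ρ

/-- Causal memory. -/
def History.IsCM {O : Type u} {M : Type v} {D : Type w} (h : History O M D)
    (S : Specification M D) : Prop :=
  ∃ co : O → O → Prop, IsStrictOrder O co ∧ (∀ a b, h.po a b → co a b) ∧
    ∀ o, ∃ ρ : List (O × OpLabel M D), ρ.map Prod.snd ∈ S ∧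
      SequencedBy (pastOf co o) co (h.keepRv (pastOf h.po o)) ρ

/-- Causal convergence. -/
def History.IsCCv {O : Type u} {M : Type v} {D : Type w} (h : History O M D)
    (S : Specification M D) : Prop :=
  ∃ co arb : O → O → Prop, IsStrictOrder O co ∧ IsStrictTotalOrder O arb ∧
    (∀ a b, h.po a b → co a b) ∧ (∀ a b, co a b → arb a b) ∧
    ∀ o, ∃ ρ : List (O × OpLabel M D), ρ.map Prod.snd ∈ S ∧
      SequencedBy (pastOf co o) arb (h.keepRv {o}) ρ

/-- The three consistency criteria. -/
inductive Criterion where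
  | CC
  | CM
  | CCv

/-- `c.Holds h S`: the history `h` satisfies `c` with respect to the specification `S`. -/
def Criterion.Holds {O : Type u} {M : Type v} {D : Type w} (c : Criterion)
    (h : History O M D) (S : Specification M D) : Prop :=
  match c with
  | .CC => h.IsCC S
  | .CM => h.IsCM S
  | .CCv => h.IsCCv S

/-! ### The read/write memory -/

inductive RWMethod where
  | wr
  | rd

/-- The domain `(X × ℕ) ⊎ X ⊎ ℕ ⊎ {⊥}` of the read/write memory with variables `X`. -/
inductive RWData (X : Type u) where
  | pair (x : X) (v : ℕ)
  | var (x : X)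
  | val (v : ℕ)
  | bot

abbrev RWLabel (X : Type u) : Type u := OpLabel RWMethod (RWData X)

/-- The label of a write of the value `v` to the variable `x`. -/
def wrLabel {X : Type u} (x : X) (v : ℕ) : RWLabel X := (.wr, .pair x v, .bot)

/-- The label of a read of the variable `x` that returns the value `v`. -/
def rdLabel {X : Type u} (x : X) (v : ℕ) : RWLabel X := (.rd, .var x, .val v)

/-- The sequences of the read/write memory; variables are initially `0`. -/
inductive RWSpec {X : Type u} : List (RWLabel X) → Prop where
  | nil : RWSpec []
  | write (ρ : List (RWLabel X)) (x : X) (v : ℕ) : RWSpec ρ → RWSpec (ρ ++ [wrLabel x v])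
  | readInit (ρ : List (RWLabel X)) (x : X) : RWSpec ρ → (∀ u, wrLabel x u ∉ ρ) →
      RWSpec (ρ ++ [rdLabel x 0])
  | read (ρ ρ₁ ρ₂ : List (RWLabel X)) (x : X) (v : ℕ) : RWSpec ρ →
      ρ = ρ₁ ++ wrLabel x v :: ρ₂ → (∀ u, wrLabel x u ∉ ρ₂) → RWSpec (ρ ++ [rdLabel x v])

/-- The specification of the read/write memory. -/
def rwMemory (X : Type u) : Specification RWMethod (RWData X) := {ρ | RWSpec ρ}

/-- A read/write memory history: every operation is a write or a read of a variable. -/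
def History.IsRW {O : Type u} {X : Type v} (h : History O RWMethod (RWData X)) : Prop :=
  ∀ o, ∃ x v, h.label o = wrLabel x v ∨ h.label o = rdLabel x v

/-- The variables that occur in a read/write memory history. -/
def History.vars {O : Type u} {X : Type v} (h : History O RWMethod (RWData X)) : Set X :=
  {x | ∃ o v, h.label o = wrLabel x v ∨ h.label o = rdLabel x v}

/-- Differentiated: no two operations write the same value to the same variable, and no operation
writes the initial value `0`. -/
def History.Differentiated {O : Type u} {X : Type v} (h : History O RWMethod (RWData X)) : Prop :=
  (∀ o₁ o₂ x d₁ d₂, o₁ ≠ o₂ → h.label o₁ = wrLabel x d₁ → h.label o₂ = wrLabel x d₂ → d₁ ≠ d₂) ∧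
  ∀ o x, h.label o ≠ wrLabel x 0

/-! ### Random access programs with a step count

Programs act on registers and finitely many named arrays of natural numbers. The only arithmetic
is addition and truncated subtraction, with comparisons; there is no multiplication. Every node of
an evaluated expression, every assignment and every test costs one step. -/

/-- The memory: registers, and named arrays. -/
structure MemState where
  reg : ℕ → ℕ
  arr : ℕ → ℕ → ℕ

/-- Expressions; `get a e` is the entry of array `a` at the index `e`. -/
inductive RamExpr where
  | const (k : ℕ)
  | reg (r : ℕ)
  | get (a : ℕ) (e : RamExpr)
  | add (e f : RamExpr)
  | sub (e f : RamExpr)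
  | eq (e f : RamExpr)
  | lt (e f : RamExpr)

/-- The value of an expression; the comparisons have the value `1` (true) or `0` (false). -/
def RamExpr.eval (s : MemState) : RamExpr → ℕ
  | .const k => k
  | .reg r => s.reg r
  | .get a e => s.arr a (e.eval s)
  | .add e f => e.eval s + f.eval s
  | .sub e f => e.eval s - f.eval s
  | .eq e f => if e.eval s = f.eval s then 1 else 0
  | .lt e f => if e.eval s < f.eval s then 1 else 0

/-- The number of steps it takes to evaluate an expression. -/
def RamExpr.cost : RamExpr → ℕ
  | .const _ => 1
  | .reg _ => 1
  | .get _ e => e.cost + 1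
  | .add e f => e.cost + f.cost + 1
  | .sub e f => e.cost + f.cost + 1
  | .eq e f => e.cost + f.cost + 1
  | .lt e f => e.cost + f.cost + 1

/-- Programs: `assign r e` sets register `r` to `e`, and `store a i e` sets the entry of array `a`
at the index `i` to `e`. A test succeeds when its value is not `0`. -/
inductive RamProg where
  | skip
  | assign (r : ℕ) (e : RamExpr)
  | store (a : ℕ) (i e : RamExpr)
  | seq (p q : RamProg)
  | ite (e : RamExpr) (p q : RamProg)
  | loop (e : RamExpr) (p : RamProg)

/-- `RamProg.Run p s s' t`: the program `p` started in `s` halts in `s'` after exactly `t` steps. -/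
inductive RamProg.Run : RamProg → MemState → MemState → ℕ → Prop where
  | skip (s : MemState) : Run .skip s s 1
  | assign (r : ℕ) (e : RamExpr) (s : MemState) :
      Run (.assign r e) s { s with reg := Function.update s.reg r (e.eval s) } (e.cost + 1)
  | store (a : ℕ) (i e : RamExpr) (s : MemState) :
      Run (.store a i e) s
        { s with arr := Function.update s.arr a (Function.update (s.arr a) (i.eval s) (e.eval s)) }
        (i.cost + e.cost + 1)
  | seq (p q : RamProg) (s s' s'' : MemState) (t t' : ℕ) :
      Run p s s' t → Run q s' s'' t' → Run (.seq p q) s s'' (t + t')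
  | ite_true (e : RamExpr) (p q : RamProg) (s s' : MemState) (t : ℕ) :
      e.eval s ≠ 0 → Run p s s' t → Run (.ite e p q) s s' (e.cost + 1 + t)
  | ite_false (e : RamExpr) (p q : RamProg) (s s' : MemState) (t : ℕ) :
      e.eval s = 0 → Run q s s' t → Run (.ite e p q) s s' (e.cost + 1 + t)
  | loop_true (e : RamExpr) (p : RamProg) (s s' s'' : MemState) (t t' : ℕ) :
      e.eval s ≠ 0 → Run p s s' t → Run (.loop e p) s' s'' t' →
      Run (.loop e p) s s'' (e.cost + 1 + t + t')
  | loop_false (e : RamExpr) (p : RamProg) (s : MemState) :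
      e.eval s = 0 → Run (.loop e p) s s (e.cost + 1)

/-! ### The representation of a history in memory -/

/-- `0` for a write, `1` for a read. -/
def methodCode {X : Type u} : RWLabel X → ℕ
  | (.wr, _, _) => 0
  | (.rd, _, _) => 1

/-- The variable of an operation, as a number; `0` if the label is not that of a write or read. -/
def varCode {X : Type u} (name : X → ℕ) : RWLabel X → ℕ
  | (.wr, .pair x _, _) => name x
  | (.rd, .var x, _) => name x
  | _ => 0

/-- The value of an operation; `0` if the label is not that of a write or read. -/
def valueCode {X : Type u} : RWLabel X → ℕ
  | (.wr, .pair _ v, _) => v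
  | (.rd, _, .val v) => v
  | _ => 0

open Classical in
/-- The initial memory on the input `h`, a history with operations `0, …, n - 1`. Register `0` holds
`n`; entry `i < n` of the arrays `0`, `1`, `2` holds the method, the variable and the value of
operation `i`; array `3` holds the program order as an `n × n` matrix of zeros and ones, row by row.
Everything else is `0`. -/
noncomputable def inputMemory {X : Type u} (name : X → ℕ) {n : ℕ}
    (h : History (Fin n) RWMethod (RWData X)) : MemState where
  reg r := if r = 0 then n else 0
  arr a k :=
    match a with
    | 0 => if hk : k < n then methodCode (h.label ⟨k, hk⟩) else 0
    | 1 => if hk : k < n then varCode name (h.label ⟨k, hk⟩) else 0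
    | 2 => if hk : k < n then valueCode (h.label ⟨k, hk⟩) else 0
    | 3 => if ∃ i j : Fin n, k = i.val * n + j.val ∧ h.po i j then 1 else 0
    | _ => 0

/-! ### Sequences of the read/write memory -/

/-! In a differentiated history a read determines the write it reads from. Every admissible causal
order contains the program order and this reads-from relation, hence their transitive closure
`History.causal`; enlarging the causal order only adds constraints, so that closure is the one
candidate to test. A sequence explains the return value of a read `r` exactly when the source of `r`
precedes it and every other write `w₁` to the same variable that precedes `r` also precedes the
source. If `r` returns the initial value, no such `w₁` may exist; `History.Conflict` encodes this by
making `w₁` precede itself. `SequencedBy.exists_order` and `exists_sequencedBy` translate between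
sequences and orders with this property.

Each criterion becomes an acyclicity statement. For CC, only one read counts at a time, and it
suffices that no write lies causally between a source and its read (`isCC_iff`). For CCv, a single
arbitration must contain every precedence forced by a causal relation `w₁` to `r`; one round of
forcing followed by transitive closure decides this (`isCCv_iff`). For CM, each operation `o` has
its own order, in which all reads of the site of `o` up to `o` count; a new precedence can put
further writes before these reads, so the forcing is iterated (`isCM_iff`).

The exponent 5 depends on `n` rounds of forcing being enough, where counting pairs would only give
about `n²`. The reads concerned lie in a chain. A forced edge `a → b` comes from a read `r'` above
`a`. If `r'` is at or before `r`, then `a` was already below `r`; so only reads later than `r` can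
enlarge the past of `r`. By induction from the end of the chain, the past of a read with `m` later
chain elements is settled after `m` rounds (`History.saturate_settled`). CM therefore costs `n`
operations times `n` rounds times `n³` for a transitive closure.

The algorithms are written in a small language of relational programs whose loop nesting gives the
exponent (`RelProg.run_compile`), with closures computed by Warshall's algorithm. -/

/-- After the sequence `ρ`, a read of `x` returns `v`. -/
def RWReturns {X : Type u} (ρ : List (RWLabel X)) (x : X) (v : ℕ) : Prop :=
  (v = 0 ∧ ∀ u, wrLabel x u ∉ ρ) ∨
    ∃ ρ₁ ρ₂, ρ = ρ₁ ++ wrLabel x v :: ρ₂ ∧ ∀ u, wrLabel x u ∉ ρ₂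

theorem rdLabel_inj {X : Type u} {x y : X} {v w : ℕ} :
    rdLabel x v = rdLabel y w ↔ x = y ∧ v = w := by
  simp [rdLabel]

theorem wrLabel_ne_rdLabel {X : Type u} {x y : X} {v w : ℕ} : wrLabel x v ≠ rdLabel y w := by
  simp [wrLabel, rdLabel]

theorem exists_rwReturns {X : Type u} (ρ : List (RWLabel X)) (x : X) : ∃ v, RWReturns ρ x v := by
  induction ρ using List.reverseRecOn with
  | nil => exact ⟨0, .inl ⟨rfl, by simp⟩⟩
  | append_singleton ρ p ih =>
    by_cases hp : ∃ v, p = wrLabel x v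
    · obtain ⟨v, rfl⟩ := hp
      exact ⟨v, .inr ⟨ρ, [], rfl, by simp⟩⟩
    · have hp' : ∀ u, wrLabel x u ≠ p := fun u hu => hp ⟨u, hu.symm⟩
      obtain ⟨v, ⟨rfl, h⟩ | ⟨ρ₁, ρ₂, rfl, h⟩⟩ := ih
      · exact ⟨0, .inl ⟨rfl, fun u => by simp [h u, hp' u]⟩⟩
      · exact ⟨v, .inr ⟨ρ₁, ρ₂ ++ [p], by simp, fun u => by simp [h u, hp' u]⟩⟩

theorem RWSpec.snoc_read {X : Type u} {ρ : List (RWLabel X)} {x : X} {v : ℕ} (h : RWSpec ρ)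
    (hr : RWReturns ρ x v) : RWSpec (ρ ++ [rdLabel x v]) := by
  obtain ⟨rfl, h'⟩ | ⟨ρ₁, ρ₂, e, h'⟩ := hr
  · exact .readInit ρ x h h'
  · exact .read ρ ρ₁ ρ₂ x v h e h'

theorem RWSpec.of_snoc {X : Type u} {ρ : List (RWLabel X)} {p : RWLabel X}
    (h : RWSpec (ρ ++ [p])) : RWSpec ρ ∧ (∃ x v, p = wrLabel x v ∨ p = rdLabel x v) ∧
      ∀ x v, p = rdLabel x v → RWReturns ρ x v := by
  generalize e : ρ ++ [p] = σ at h
  cases h with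
  | nil => simp at e
  | write τ x v h =>
    obtain ⟨rfl, e'⟩ := List.append_inj' e rfl
    obtain rfl : p = wrLabel x v := by simpa using e'
    exact ⟨h, ⟨x, v, .inl rfl⟩, fun y w hw => (wrLabel_ne_rdLabel hw).elim⟩
  | readInit τ x h h' =>
    obtain ⟨rfl, e'⟩ := List.append_inj' e rfl
    obtain rfl : p = rdLabel x 0 := by simpa using e'
    refine ⟨h, ⟨x, 0, .inr rfl⟩, fun y w hw => ?_⟩
    obtain ⟨rfl, rfl⟩ := rdLabel_inj.1 hw
    exact .inl ⟨rfl, h'⟩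
  | read τ τ₁ τ₂ x v h e₁ h' =>
    obtain ⟨rfl, e'⟩ := List.append_inj' e rfl
    obtain rfl : p = rdLabel x v := by simpa using e'
    refine ⟨h, ⟨x, v, .inr rfl⟩, fun y w hw => ?_⟩
    obtain ⟨rfl, rfl⟩ := rdLabel_inj.1 hw
    exact .inr ⟨τ₁, τ₂, e₁, h'⟩

theorem RWSpec.of_append {X : Type u} {ρ σ : List (RWLabel X)} (h : RWSpec (ρ ++ σ)) :
    RWSpec ρ := by
  induction σ using List.reverseRecOn with
  | nil => simpa using h
  | append_singleton σ p ih => exact ih (RWSpec.of_snoc (by simpa using h)).1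

theorem RWSpec.label_of_mem {X : Type u} {ρ : List (RWLabel X)} (h : RWSpec ρ) {p : RWLabel X}
    (hp : p ∈ ρ) : ∃ x v, p = wrLabel x v ∨ p = rdLabel x v := by
  obtain ⟨ρ₁, ρ₂, rfl⟩ := List.append_of_mem hp
  exact (RWSpec.of_snoc (RWSpec.of_append (σ := ρ₂) (by simpa using h))).2.1

/-! ### Reads-from and conflicts -/

section Conflict

variable {O : Type u} {X : Type v} (h : History O RWMethod (RWData X))

/-- The read `r` returns the value that `w` writes. -/
def History.ReadsFrom (w r : O) : Prop :=
  ∃ x v, h.label w = wrLabel x v ∧ h.label r = rdLabel x v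

/-- The read `r` does not return the initial value. -/
def History.NeedsSource (r : O) : Prop := ∃ x v, h.label r = rdLabel x v ∧ v ≠ 0

/-- If the write `w₁` precedes the read `r` of the same variable, then it precedes `w₂`. Here `w₂`
is the source of `r` if there is one; if `r` returns the initial value, then `w₂ = w₁`, so that
`w₁` cannot precede `r`. -/
def History.Conflict (w₁ r w₂ : O) : Prop :=
  ∃ x v, h.label r = rdLabel x v ∧ (∃ u, h.label w₁ = wrLabel x u) ∧
    ((h.label w₂ = wrLabel x v ∧ w₁ ≠ w₂) ∨ (v = 0 ∧ w₂ = w₁))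

/-- In the order `lt` of `A`, the read `r` returns the last preceding value. -/
def History.Respects (lt : O → O → Prop) (A : Set O) (r : O) : Prop :=
  (h.NeedsSource r → ∃ w ∈ A, lt w r ∧ h.ReadsFrom w r) ∧
    ∀ w₁ ∈ A, lt w₁ r → ∀ w₂, h.Conflict w₁ r w₂ → lt w₁ w₂

variable {h}

theorem History.Differentiated.eq_of_label (hd : h.Differentiated) {a b : O} {x : X} {v : ℕ}
    (ha : h.label a = wrLabel x v) (hb : h.label b = wrLabel x v) : a = b := by
  by_contra hab
  exact hd.1 a b x v v hab ha hb rfl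

theorem History.Differentiated.source_unique (hd : h.Differentiated) {w w' r : O}
    (h₁ : h.ReadsFrom w r) (h₂ : h.ReadsFrom w' r) : w = w' := by
  obtain ⟨x, v, hw, hr⟩ := h₁
  obtain ⟨y, v', hw', hr'⟩ := h₂
  obtain ⟨rfl, rfl⟩ := rdLabel_inj.1 (hr.symm.trans hr')
  exact hd.eq_of_label hw hw'

theorem History.Differentiated.needsSource (hd : h.Differentiated) {w r : O}
    (h₁ : h.ReadsFrom w r) : h.NeedsSource r := by
  obtain ⟨x, v, hw, hr⟩ := h₁
  exact ⟨x, v, hr, fun hv => hd.2 w x (hv ▸ hw)⟩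

theorem History.Conflict.eq_or_readsFrom {w₁ r w₂ : O} (hc : h.Conflict w₁ r w₂) :
    w₁ = w₂ ∨ h.ReadsFrom w₂ r := by
  obtain ⟨x, v, hr, -, ⟨hw, -⟩ | ⟨-, rfl⟩⟩ := hc
  · exact .inr ⟨x, v, hw, hr⟩
  · exact .inl rfl

/-! ### Orders that explain return values -/

theorem label_eq_of_refines {K : Set O} {p : O × RWLabel X} (hK : p.1 ∈ K)
    (hp : LabelRefines (h.keepRv K p.1) p.2) : p.2 = h.label p.1 := by
  obtain ⟨h₁, h₂, h₃⟩ := hp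
  refine Prod.ext h₁.symm (Prod.ext h₂.symm (h₃ _ ?_).symm)
  simp [History.keepRv, hK]

/-- Hiding return values loses nothing about writes: in a sequence of the memory the return value of
a write can only be `⊥`. -/
theorem label_eq_wrLabel_iff (hrw : h.IsRW) {K : Set O} {p : O × RWLabel X}
    (hp : LabelRefines (h.keepRv K p.1) p.2) (hp' : ∃ x v, p.2 = wrLabel x v ∨ p.2 = rdLabel x v)
    {x : X} {v : ℕ} : h.label p.1 = wrLabel x v ↔ p.2 = wrLabel x v := by
  obtain ⟨h₁, h₂, -⟩ := hp
  obtain ⟨y, w, hy⟩ := hrw p.1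
  obtain ⟨y', w', hy'⟩ := hp'
  simp only [History.keepRv] at h₁ h₂
  rcases hy with hy | hy <;> rcases hy' with hy' | hy' <;> rw [hy, hy'] at h₁ h₂ ⊢ <;>
    simp_all [wrLabel, rdLabel]

/-- The order is that of positions in `ρ`. The last write before a kept read must be its source,
because a value identifies its write. -/
theorem SequencedBy.exists_order (hrw : h.IsRW) (hd : h.Differentiated) {A K : Set O}
    {R : O → O → Prop} {ρ : List (O × RWLabel X)} (hρ : ρ.map Prod.snd ∈ rwMemory X)
    (hs : SequencedBy A R (h.keepRv K) ρ) :
    ∃ lt : O → O → Prop, IsStrictOrder O lt ∧ (∀ a ∈ A, ∀ b ∈ A, a ≠ b → lt a b ∨ lt b a) ∧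
      (∀ a ∈ A, ∀ b ∈ A, R a b → lt a b) ∧ ∀ r ∈ A, r ∈ K → h.Respects lt A r := by
  classical
  obtain ⟨hnd, hA, hR, hl⟩ := hs
  have hlab : ∀ p ∈ ρ, ∀ x v, h.label p.1 = wrLabel x v ↔ p.2 = wrLabel x v := fun p hp x v =>
    label_eq_wrLabel_iff hrw (hl p hp) (RWSpec.label_of_mem hρ (List.mem_map_of_mem hp))
  have hpw : (ρ.map Prod.fst).Pairwise
      (fun a b => (ρ.map Prod.fst).idxOf a < (ρ.map Prod.fst).idxOf b) := by
    rw [List.pairwise_iff_getElem]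
    intro i j hi hj hij
    rwa [hnd.idxOf_getElem, hnd.idxOf_getElem]
  refine ⟨fun a b => (ρ.map Prod.fst).idxOf a < (ρ.map Prod.fst).idxOf b,
    { irrefl := fun a => lt_irrefl _, trans := fun a b c => lt_trans }, ?_, ?_, ?_⟩
  · intro a ha b hb hab
    refine lt_or_gt_of_ne fun e => hab ?_
    exact (List.idxOf_inj ((hA a).2 ha)).1 e
  · intro a ha b hb hab
    simpa using hpw.sublist (hR a ha b hb hab)
  · intro r hr hrK
    obtain ⟨p, hp, rfl⟩ := List.mem_map.1 ((hA r).2 hr)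
    have hp2 := label_eq_of_refines hrK (hl p hp)
    generalize hlt : (fun a b => (ρ.map Prod.fst).idxOf a < (ρ.map Prod.fst).idxOf b) = lt at *
    have hirr : ∀ a, ¬ lt a a := by rw [← hlt]; exact fun a => lt_irrefl _
    have htr : ∀ a b c, lt a b → lt b c → lt a c := by rw [← hlt]; exact fun a b c => lt_trans
    obtain ⟨ρ₁, ρ₂, rfl⟩ := List.append_of_mem hp
    simp only [List.map_append, List.map_cons, List.pairwise_append, List.pairwise_cons] at hpw
    obtain ⟨hpw₁, ⟨hpw₂, -⟩, hpw₃⟩ := hpw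
    have hret : ∀ x v, p.2 = rdLabel x v → RWReturns (ρ₁.map Prod.snd) x v := by
      have : RWSpec (ρ₁.map Prod.snd ++ [p.2]) := by
        refine RWSpec.of_append (σ := ρ₂.map Prod.snd) ?_
        have hρ' : RWSpec _ := hρ
        simpa using hρ'
      exact (RWSpec.of_snoc this).2.2
    have hmem : ∀ a ∈ A, lt a p.1 → ∃ q ∈ ρ₁, q.1 = a := by
      intro a ha hap
      obtain ⟨q, hq, rfl⟩ := List.mem_map.1 ((hA a).2 ha)
      rcases List.mem_append.1 hq with hq | hq
      · exact ⟨q, hq, rfl⟩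
      · rcases List.mem_cons.1 hq with rfl | hq
        · exact (hirr _ hap).elim
        · exact (hirr _ (htr _ _ _ hap (hpw₂ q.1 (List.mem_map_of_mem hq)))).elim
    constructor
    · rintro ⟨x, v, hx, hv⟩
      obtain ⟨hv', -⟩ | ⟨σ₁, σ₂, hσ, -⟩ := hret x v (hp2.trans hx)
      · exact (hv hv').elim
      obtain ⟨q, hq, hq2⟩ := List.mem_map.1 (show wrLabel x v ∈ ρ₁.map Prod.snd by rw [hσ]; simp)
      have hqρ : q ∈ ρ₁ ++ p :: ρ₂ := List.mem_append_left _ hq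
      exact ⟨q.1, (hA _).1 (List.mem_map_of_mem hqρ),
        hpw₃ _ (List.mem_map_of_mem hq) _ (by simp), x, v, (hlab q hqρ x v).2 hq2, hx⟩
    · rintro w₁ hw₁ hlt₁ w₂ ⟨x, v, hx, ⟨u, hu⟩, hw₂⟩
      obtain ⟨q₁, hq₁, rfl⟩ := hmem w₁ hw₁ hlt₁
      have hq₁' := (hlab q₁ (List.mem_append_left _ hq₁) x u).1 hu
      obtain ⟨rfl, hno⟩ | ⟨σ₁, σ₂, hσ, hno⟩ := hret x v (hp2.trans hx)
      · exact (hno u (hq₁' ▸ List.mem_map_of_mem hq₁)).elim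
      obtain ⟨τ₁, τ₂, rfl, rfl, hτ₂⟩ := List.map_eq_append_iff.1 hσ
      obtain ⟨q, τ₂, rfl, hq, rfl⟩ := List.map_eq_cons_iff.1 hτ₂
      have hq' := (hlab q (by simp) x v).2 hq
      obtain ⟨hw₂, hne⟩ | ⟨rfl, -⟩ := hw₂
      · obtain rfl := hd.eq_of_label hw₂ hq'
        simp only [List.map_append, List.map_cons, List.pairwise_append] at hpw₁
        rcases List.mem_append.1 hq₁ with hq₁ | hq₁
        · exact hpw₁.2.2 _ (List.mem_map_of_mem hq₁) _ (by simp)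
        · rcases List.mem_cons.1 hq₁ with rfl | hq₁
          · exact (hne rfl).elim
          · exact (hno u (hq₁' ▸ List.mem_map_of_mem hq₁)).elim
      -- Here the read returns `0`, yet the sequence supplies a write of that value, which
      -- differentiatedness forbids.
      · exact (hd.2 _ _ hq').elim

theorem exists_sorted_list [Finite O] (A : Set O) (lt : O → O → Prop)
    [hlt : IsStrictTotalOrder O lt] :
    ∃ l : List O, l.Pairwise lt ∧ ∀ a, a ∈ l ↔ a ∈ A := by
  classical
  have := Fintype.ofFinite O
  let := linearOrderOfSTO lt
  refine ⟨A.toFinset.sort, ?_, by simp⟩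
  exact (Finset.sortedLT_sort A.toFinset).pairwise

/-- List `A` in increasing order and choose labels along the prefixes: a hidden read takes whatever
the memory returns at that point, and a kept read is correct by `History.Respects`. -/
theorem exists_sequencedBy [Finite O] (hrw : h.IsRW) {A K : Set O}
    {R lt : O → O → Prop} [hlt : IsStrictTotalOrder O lt] (hR : ∀ a ∈ A, ∀ b ∈ A, R a b → lt a b)
    (hresp : ∀ r ∈ A, r ∈ K → h.Respects lt A r) :
    ∃ ρ : List (O × RWLabel X), ρ.map Prod.snd ∈ rwMemory X ∧
      SequencedBy A R (h.keepRv K) ρ := by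
  classical
  obtain ⟨l, hl, hA⟩ := exists_sorted_list A lt
  have hirr : ∀ a, ¬ lt a a := hlt.irrefl
  have htr : ∀ a b c, lt a b → lt b c → lt a c := hlt.trans
  have hsub : ∀ a ∈ A, ∀ b ∈ A, R a b → List.Sublist [a, b] l := by
    intro a ha b hb hab
    obtain ⟨s, t, rfl⟩ := List.append_of_mem ((hA a).2 ha)
    simp only [List.pairwise_append, List.pairwise_cons] at hl
    have hab := hR a ha b hb hab
    have hb' := (hA b).2 hb
    rcases List.mem_append.1 hb' with hb' | hb'
    · exact (hirr _ (htr _ _ _ hab (hl.2.2 b hb' a (by simp)))).elim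
    · rcases List.mem_cons.1 hb' with rfl | hb'
      · exact (hirr _ hab).elim
      · exact ((List.singleton_sublist.2 hb').cons_cons a).trans (List.sublist_append_right _ _)
  have key : ∀ l₁ l₂ : List O, l = l₁ ++ l₂ → ∃ ρ : List (O × RWLabel X), ρ.map Prod.fst = l₁ ∧
      RWSpec (ρ.map Prod.snd) ∧ ∀ p ∈ ρ, LabelRefines (h.keepRv K p.1) p.2 := by
    intro l₁
    induction l₁ using List.reverseRecOn with
    | nil => exact fun _ _ => ⟨[], rfl, .nil, by simp⟩
    | append_singleton l₁ r ih =>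
      intro l₂ e
      obtain ⟨ρ, h₁, h₂, h₃⟩ := ih (r :: l₂) (by simpa using e)
      suffices ∃ p : RWLabel X, RWSpec (ρ.map Prod.snd ++ [p]) ∧ LabelRefines (h.keepRv K r) p by
        obtain ⟨p, hp₁, hp₂⟩ := this
        refine ⟨ρ ++ [(r, p)], by simp [h₁], by simpa using hp₁, fun q hq => ?_⟩
        rcases List.mem_append.1 hq with hq | hq
        · exact h₃ q hq
        · obtain rfl : q = (r, p) := by simpa using hq
          exact hp₂
      obtain ⟨x, v, hx | hx⟩ := hrw r
      · exact ⟨wrLabel x v, .write _ _ _ h₂, by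
          simp [LabelRefines, History.keepRv, hx, wrLabel]⟩
      by_cases hrK : r ∈ K
      swap
      · obtain ⟨u, hu⟩ := exists_rwReturns (ρ.map Prod.snd) x
        exact ⟨rdLabel x u, h₂.snoc_read hu, by
          simp [LabelRefines, History.keepRv, hx, rdLabel, hrK]⟩
      refine ⟨rdLabel x v, h₂.snoc_read ?_, by
          simp [LabelRefines, History.keepRv, hx, rdLabel, hrK]⟩
      have hlab : ∀ p ∈ ρ, ∀ x v, h.label p.1 = wrLabel x v ↔ p.2 = wrLabel x v := fun p hp x v =>
        label_eq_wrLabel_iff hrw (h₃ p hp) (RWSpec.label_of_mem h₂ (List.mem_map_of_mem hp))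
      have hrA : r ∈ A := (hA r).1 (by simp [e])
      obtain ⟨hn, hc⟩ := hresp r hrA hrK
      have hl' := hl
      rw [e] at hl'
      simp only [List.append_assoc, List.singleton_append, List.pairwise_append,
        List.pairwise_cons] at hl'
      obtain ⟨hl₁, ⟨hl₂, -⟩, hl₃⟩ := hl'
      have hmem : ∀ q ∈ ρ, q.1 ∈ A ∧ lt q.1 r := by
        intro q hq
        have : q.1 ∈ l₁ := h₁ ▸ List.mem_map_of_mem hq
        exact ⟨(hA _).1 (by simp [e, this]), hl₃ _ this _ (by simp)⟩
      by_cases hv : v = 0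
      · refine .inl ⟨hv, fun u hu => ?_⟩
        obtain ⟨q, hq, hq2⟩ := List.mem_map.1 hu
        exact hirr _ (hc q.1 (hmem q hq).1 (hmem q hq).2 q.1
          ⟨x, v, hx, ⟨u, (hlab q hq x u).2 hq2⟩, .inr ⟨hv, rfl⟩⟩)
      · obtain ⟨w, hwA, hwr, y, v', hw, hy⟩ := hn ⟨x, v, hx, hv⟩
        obtain ⟨rfl, rfl⟩ := rdLabel_inj.1 (hx.symm.trans hy)
        have hwl : w ∈ ρ.map Prod.fst := by
          have := (hA w).2 hwA
          rw [e] at this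
          simp only [List.append_assoc, List.singleton_append, List.mem_append,
            List.mem_cons] at this
          rcases this with this | rfl | this
          · exact h₁ ▸ this
          · exact (hirr _ hwr).elim
          · exact (hirr _ (htr _ _ _ hwr (hl₂ _ this))).elim
        obtain ⟨q, hq, rfl⟩ := List.mem_map.1 hwl
        have hq2 := (hlab q hq x v).1 hw
        obtain ⟨ρ₁, ρ₂, rfl⟩ := List.append_of_mem hq
        refine .inr ⟨ρ₁.map Prod.snd, ρ₂.map Prod.snd, by simp [hq2], fun u hu => ?_⟩
        obtain ⟨q', hq', hq2'⟩ := List.mem_map.1 hu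
        have hq'' : q' ∈ ρ₁ ++ q :: ρ₂ := by simp [hq']
        have hlt' : lt q.1 q'.1 := by
          rw [← h₁] at hl₁
          simp only [List.map_append, List.map_cons, List.pairwise_append,
            List.pairwise_cons] at hl₁
          exact hl₁.2.1.1 _ (List.mem_map_of_mem hq')
        refine hirr _ (htr _ _ _ hlt' (hc q'.1 (hmem _ hq'').1 (hmem _ hq'').2 q.1
          ⟨x, v, hx, ⟨u, (hlab q' hq'' x u).2 hq2'⟩, .inl ⟨hw, fun e => ?_⟩⟩))
        exact hirr _ (e ▸ hlt')
  obtain ⟨ρ, h₁, h₂, h₃⟩ := key l [] (by simp)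
  refine ⟨ρ, h₂, ?_, ?_, ?_, h₃⟩
  · rw [h₁]
    refine List.Pairwise.imp ?_ hl
    rintro a b hab rfl
    exact hirr _ hab
  · rwa [h₁]
  · rwa [h₁]

end Conflict

/-! ### Characterisations of the three criteria -/

/-- A strict partial order extends to a strict total order that refines a monotone function. -/
theorem exists_total_extension {O : Type u} {R : O → O → Prop} (hR : IsStrictOrder O R)
    (f : O → ℕ) (hf : ∀ a b, R a b → f a ≤ f b) :
    ∃ lt : O → O → Prop, IsStrictTotalOrder O lt ∧ (∀ a b, R a b → lt a b) ∧
      ∀ a b, f a < f b → lt a b := by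
  -- Compare lexicographically, by `f` and then by `R`, and extend this partial order to a total
  -- one.
  let r : O → O → Prop := fun a b => a = b ∨ f a < f b ∨ (f a = f b ∧ R a b)
  have hr : IsPartialOrder O r :=
    { refl := fun a => .inl rfl
      trans := by
        rintro a b c (rfl | h | ⟨h, h'⟩) (rfl | k | ⟨k, k'⟩)
        · exact .inl rfl
        · exact .inr (.inl k)
        · exact .inr (.inr ⟨k, k'⟩)
        · exact .inr (.inl h)
        · exact .inr (.inl (h.trans k))
        · exact .inr (.inl (k ▸ h))
        · exact .inr (.inr ⟨h, h'⟩)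
        · exact .inr (.inl (h ▸ k))
        · exact .inr (.inr ⟨h.trans k, hR.trans _ _ _ h' k'⟩)
      antisymm := by
        rintro a b (rfl | h | ⟨h, h'⟩) (k | k | ⟨k, k'⟩)
        all_goals first | rfl | exact k.symm | omega | skip
        exact (hR.irrefl _ (hR.trans _ _ _ h' k')).elim }
  obtain ⟨s, hs, hrs⟩ := extend_partialOrder r
  refine ⟨fun a b => s a b ∧ a ≠ b, ?_, fun a b hab => ⟨hrs a b ?_, ?_⟩,
    fun a b hab => ⟨hrs a b (.inr (.inl hab)), ?_⟩⟩
  · exact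
      { irrefl := fun a h => h.2 rfl
        trans := by
          rintro a b c ⟨h, h'⟩ ⟨k, k'⟩
          refine ⟨hs.trans _ _ _ h k, ?_⟩
          rintro rfl
          exact h' (hs.antisymm _ _ h k)
        trichotomous := by
          intro a b h k
          by_contra hne
          rcases hs.total a b with h' | h'
          · exact h ⟨h', hne⟩
          · exact k ⟨h', Ne.symm hne⟩ }
  · rcases (hf a b hab).lt_or_eq with h | h
    · exact .inr (.inl h)
    · exact .inr (.inr ⟨h, hab⟩)
  · rintro rfl
    exact hR.irrefl _ hab
  · rintro rfl
    exact lt_irrefl _ hab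

theorem isStrictOrder_transGen {O : Type u} {R : O → O → Prop}
    (h : ∀ a, ¬ Relation.TransGen R a a) : IsStrictOrder O (Relation.TransGen R) :=
  { irrefl := h, trans := fun _ _ _ => .trans }

theorem transGen_le {O : Type u} {R S : O → O → Prop} (hS : ∀ a b c, S a b → S b c → S a c)
    (h : ∀ a b, R a b → S a b) {a b : O} (hab : Relation.TransGen R a b) : S a b := by
  induction hab with
  | single h' => exact h _ _ h'
  | tail _ h' ih => exact hS _ _ _ ih (h _ _ h')

section Characterisation

variable {O : Type u} {X : Type v} (h : History O RWMethod (RWData X))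

/-- The least transitive relation that contains the program order and reads-from. -/
def History.causal : O → O → Prop :=
  Relation.TransGen fun a b => h.po a b ∨ h.ReadsFrom a b

/-- Every read of a non-initial value has a source. -/
def History.HasSources : Prop := ∀ r, h.NeedsSource r → ∃ w, h.ReadsFrom w r

/-- The order between writes that is forced by the reads in `K` and the order `H`. -/
def History.Forced (K : Set O) (H : O → O → Prop) (a b : O) : Prop :=
  ∃ r ∈ K, h.Conflict a r b ∧ H a r

/-- One round of the saturation of `H` by the order that the reads in `K` force. -/
def History.saturate (K : Set O) (H : O → O → Prop) : O → O → Prop :=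
  Relation.TransGen fun a b => H a b ∨ h.Forced K H a b

/-- The causal order, restricted to the causal past of `o`. -/
def History.causalTo (o a b : O) : Prop := h.causal a b ∧ b ∈ pastOf h.causal o

variable {h}

theorem mem_pastOf_of_rel {R : O → O → Prop} (ht : ∀ a b c, R a b → R b c → R a c) {a b o : O}
    (hab : R a b) (hb : b ∈ pastOf R o) : a ∈ pastOf R o := by
  rcases hb with hb | rfl
  · exact .inl (ht _ _ _ hab hb)
  · exact .inl hab

/-- An order in which every operation respects its own return value is a causal order. -/
theorem History.Respects.causal_le (hd : h.Differentiated) {co : O → O → Prop}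
    (hco : IsStrictOrder O co) (hpo : ∀ a b, h.po a b → co a b)
    (hr : ∀ o, ∃ lt : O → O → Prop, IsStrictOrder O lt ∧ h.Respects lt (pastOf co o) o) :
    h.HasSources ∧ ∀ a b, h.causal a b → co a b := by
  -- The source of `r` lies in the `co`-past of `r` and differs from `r`, so `co` contains
  -- reads-from.
  have key : ∀ r, h.NeedsSource r → ∃ w, co w r ∧ h.ReadsFrom w r := by
    intro r hn
    obtain ⟨lt, hlt, hresp⟩ := hr r
    obtain ⟨w, hw, hwr, hrf⟩ := hresp.1 hn
    rcases hw with hw | rfl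
    · exact ⟨w, hw, hrf⟩
    · exact (hlt.irrefl _ hwr).elim
  refine ⟨fun r hn => ?_, fun a b hab => transGen_le hco.trans ?_ hab⟩
  · obtain ⟨w, -, hw⟩ := key r hn
    exact ⟨w, hw⟩
  · rintro a b (hab | hab)
    · exact hpo a b hab
    · obtain ⟨w, hw, hw'⟩ := key b (hd.needsSource hab)
      exact hd.source_unique hw' hab ▸ hw

/-- Orders for different operations are independent. To explain `o`, delay its source and everything
causally after it behind all other operations; a conflicting write in the past of `o` is never
delayed, since it is not causally after the source. -/
theorem isCC_iff [Finite O] (hrw : h.IsRW) (hd : h.Differentiated) :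
    h.IsCC (rwMemory X) ↔ h.HasSources ∧ (∀ a, ¬ h.causal a a) ∧
      ∀ w₁ r w₂, h.Conflict w₁ r w₂ → h.causal w₁ r → ¬ (w₁ = w₂ ∨ h.causal w₂ w₁) := by
  constructor
  · rintro ⟨co, hco, hpo, hρ⟩
    have hρ' : ∀ o, ∃ lt : O → O → Prop, IsStrictOrder O lt ∧
        (∀ a ∈ pastOf co o, ∀ b ∈ pastOf co o, co a b → lt a b) ∧
        h.Respects lt (pastOf co o) o := by
      intro o
      obtain ⟨ρ, h₁, h₂⟩ := hρ o
      obtain ⟨lt, hlt, -, hR, hresp⟩ := h₂.exists_order hrw hd h₁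
      exact ⟨lt, hlt, hR, hresp o (.inr rfl) rfl⟩
    obtain ⟨hsrc, hle⟩ := History.Respects.causal_le hd hco hpo fun o => by
      obtain ⟨lt, h₁, -, h₂⟩ := hρ' o
      exact ⟨lt, h₁, h₂⟩
    refine ⟨hsrc, fun a ha => hco.irrefl _ (hle _ _ ha), fun w₁ r w₂ hc hw₁ hw₂ => ?_⟩
    obtain ⟨lt, hlt, hR, -, hresp⟩ := hρ' r
    have hm₁ : w₁ ∈ pastOf co r := .inl (hle _ _ hw₁)
    have := hresp w₁ hm₁ (hR _ hm₁ _ (.inr rfl) (hle _ _ hw₁)) w₂ hc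
    rcases hw₂ with rfl | hw₂
    · exact hlt.irrefl _ this
    · have hm₂ := mem_pastOf_of_rel hco.trans (hle _ _ hw₂) hm₁
      exact hlt.irrefl _ (hlt.trans _ _ _ this (hR _ hm₂ _ hm₁ (hle _ _ hw₂)))
  · rintro ⟨hsrc, hirr, hbad⟩
    have hco : IsStrictOrder O h.causal := isStrictOrder_transGen hirr
    refine ⟨h.causal, hco, fun a b hab => .single (.inl hab), fun o => ?_⟩
    classical
    obtain ⟨lt, hlt, hle, hf⟩ := exists_total_extension hco
      -- The indicator of the causal up-set of the source of `o`, which is monotone for the causal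
      -- order.
      (fun a => if ∃ w, h.ReadsFrom w o ∧ (w = a ∨ h.causal w a) then 1 else 0) (by
        intro a b hab
        split_ifs with h₁ h₂
        · exact le_rfl
        · obtain ⟨w, hw, hwa⟩ := h₁
          refine (h₂ ⟨w, hw, .inr ?_⟩).elim
          rcases hwa with rfl | hwa
          · exact hab
          · exact hwa.trans hab
        · exact Nat.zero_le _
        · exact le_rfl)
    refine exists_sequencedBy hrw (lt := lt) (fun a _ b _ hab => hle a b hab) ?_
    rintro r - rfl
    refine ⟨fun hn => ?_, fun w₁ hw₁ hlt₁ w₂ hc => ?_⟩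
    · obtain ⟨w, hw⟩ := hsrc r hn
      have : h.causal w r := .single (.inr hw)
      exact ⟨w, .inl this, hle _ _ this, hw⟩
    · have hw₁ : h.causal w₁ r := by
        rcases hw₁ with hw₁ | rfl
        · exact hw₁
        · exact (hlt.irrefl _ hlt₁).elim
      have hno := hbad _ _ _ hc hw₁
      rcases hc.eq_or_readsFrom with rfl | hrf
      · exact (hno (.inl rfl)).elim
      · apply hf
        have h₂ : ∃ w, h.ReadsFrom w r ∧ (w = w₂ ∨ h.causal w w₂) := ⟨w₂, hrf, .inl rfl⟩
        have h₁ : ¬ ∃ w, h.ReadsFrom w r ∧ (w = w₁ ∨ h.causal w w₁) := by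
          rintro ⟨w, hw, hw'⟩
          obtain rfl := hd.source_unique hw hrf
          exact hno (hw'.imp Eq.symm id)
        simp [h₁, h₂]

/-- One round suffices: which writes are visible to a read depends on the causal order alone, so new
arbitration edges force nothing further. -/
theorem isCCv_iff [Finite O] (hrw : h.IsRW) (hd : h.Differentiated) :
    h.IsCCv (rwMemory X) ↔ h.HasSources ∧ ∀ a, ¬ h.saturate Set.univ h.causal a a := by
  constructor
  · rintro ⟨co, arb, hco, harb, hpo, hca, hρ⟩
    have hρ' : ∀ o, ∃ lt : O → O → Prop, IsStrictOrder O lt ∧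
        (∀ a ∈ pastOf co o, ∀ b ∈ pastOf co o, arb a b → lt a b) ∧
        h.Respects lt (pastOf co o) o := by
      intro o
      obtain ⟨ρ, h₁, h₂⟩ := hρ o
      obtain ⟨lt, hlt, -, hR, hresp⟩ := h₂.exists_order hrw hd h₁
      exact ⟨lt, hlt, hR, hresp o (.inr rfl) rfl⟩
    obtain ⟨hsrc, hle⟩ := History.Respects.causal_le hd hco hpo fun o => by
      obtain ⟨lt, h₁, -, h₂⟩ := hρ' o
      exact ⟨lt, h₁, h₂⟩
    refine ⟨hsrc, fun a ha => harb.irrefl a (transGen_le harb.trans ?_ ha)⟩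
    rintro w₁ w₂ (h₁ | ⟨r, -, hc, hw₁⟩)
    · exact hca _ _ (hle _ _ h₁)
    · obtain ⟨lt, hlt, hR, -, hresp⟩ := hρ' r
      have hm₁ : w₁ ∈ pastOf co r := .inl (hle _ _ hw₁)
      have hlt₁ := hresp w₁ hm₁ (hR _ hm₁ _ (.inr rfl) (hca _ _ (hle _ _ hw₁))) w₂ hc
      rcases hc.eq_or_readsFrom with rfl | hrf
      · exact (hlt.irrefl _ hlt₁).elim
      -- Both writes are in the past of `r`, where the explaining order contains `arb`; totality of
      -- `arb` then decides their order.
      · have hm₂ : w₂ ∈ pastOf co r := .inl (hle _ _ (.single (.inr hrf)))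
        by_contra hno
        by_cases hno' : arb w₂ w₁
        · exact hlt.irrefl _ (hlt.trans _ _ _ hlt₁ (hR _ hm₂ _ hm₁ hno'))
        · obtain rfl := harb.trichotomous _ _ hno hno'
          exact hlt.irrefl _ hlt₁
  · rintro ⟨hsrc, hirr⟩
    obtain ⟨arb, harb, hle, -⟩ := exists_total_extension
      (isStrictOrder_transGen hirr) (fun _ => 0) (fun _ _ _ => le_rfl)
    have hca : ∀ a b, h.causal a b → arb a b := fun a b hab => hle _ _ (.single (.inl hab))
    have hco : IsStrictOrder O h.causal :=
      isStrictOrder_transGen fun a ha => harb.irrefl _ (hca _ _ ha)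
    refine ⟨h.causal, arb, hco, harb, fun a b hab => .single (.inl hab), hca, fun o => ?_⟩
    refine exists_sequencedBy hrw (lt := arb) (fun _ _ _ _ hab => hab) ?_
    rintro r - rfl
    refine ⟨fun hn => ?_, fun w₁ hw₁ hlt₁ w₂ hc => ?_⟩
    · obtain ⟨w, hw⟩ := hsrc r hn
      have : h.causal w r := .single (.inr hw)
      exact ⟨w, .inl this, hca _ _ this, hw⟩
    · rcases hw₁ with hw₁ | rfl
      · exact hle _ _ (.single (.inr ⟨r, trivial, hc, hw₁⟩))
      · exact (harb.irrefl _ hlt₁).elim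

/-! ### Iterated saturation along a chain, and causal memory. -/

theorem History.le_saturate {K : Set O} {H : O → O → Prop} {a b : O} (hab : H a b) :
    h.saturate K H a b := .single (.inl hab)

theorem History.le_iterate_saturate {K : Set O} {H : O → O → Prop} {a b : O}
    {m k : ℕ} (hmk : m ≤ k) (hab : ((h.saturate K)^[m] H) a b) :
    ((h.saturate K)^[k] H) a b := by
  induction k, hmk using Nat.le_induction with
  | base => exact hab
  | succ k _ ih =>
    rw [Function.iterate_succ_apply']
    exact History.le_saturate ih

theorem History.iterate_saturate_trans {K : Set O} {H : O → O → Prop}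
    (hH : ∀ a b c, H a b → H b c → H a c) (m : ℕ) {a b c : O}
    (hab : ((h.saturate K)^[m] H) a b) (hbc : ((h.saturate K)^[m] H) b c) :
    ((h.saturate K)^[m] H) a c := by
  cases m with
  | zero => exact hH _ _ _ hab hbc
  | succ m =>
    rw [Function.iterate_succ_apply'] at *
    exact Relation.TransGen.trans hab hbc

/-- The number of operations of `K` that come after `r` in the program order. -/
noncomputable def History.laterCount [Finite O] (h : History O RWMethod (RWData X)) (K : Set O)
    (r : O) : ℕ := {r' | h.po r r' ∧ r' ∈ K}.ncard

theorem History.laterCount_lt [Finite O] {K : Set O} {r r' : O} (hK : r' ∈ K) (hr : h.po r r') :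
    h.laterCount K r' < h.laterCount K r := by
  refine Set.ncard_lt_ncard ⟨fun s hs => ⟨h.po_strict.trans _ _ _ hr hs.1, hs.2⟩, fun hs => ?_⟩
    (Set.toFinite _)
  exact h.po_strict.irrefl _ (hs ⟨hr, hK⟩).1

/-- If `K` is a chain of the program order, then after `m` rounds of the saturation the operations
below an element of `K` that has at most `m` successors in `K` no longer change. -/
theorem History.saturate_settled [Finite O] {K : Set O} {H : O → O → Prop}
    (hH : ∀ a b c, H a b → H b c → H a c)
    (hK : ∀ r ∈ K, ∀ r' ∈ K, r = r' ∨ h.po r r' ∨ h.po r' r)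
    (hpo : ∀ r ∈ K, ∀ r' ∈ K, h.po r r' → H r r') (m : ℕ) :
    ∀ r ∈ K, h.laterCount K r ≤ m → ∀ a, ((h.saturate K)^[m + 1] H) a r →
      ((h.saturate K)^[m] H) a r := by
  induction m with
  | zero =>
    intro r hr hc a ha
    refine Relation.TransGen.head_induction_on (motive := fun a _ => H a r) ha ?_ ?_
    all_goals
      -- Without later elements in `K`, `r` is the last of the chain, so the tail of any forced edge
      -- was already below `r`.
      have hlast : ∀ r' ∈ K, r' = r ∨ H r' r := by
        intro r' hr'
        rcases hK r' hr' r hr with e | e | e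
        · exact .inl e
        · exact .inr (hpo _ hr' _ hr e)
        · have := History.laterCount_lt hr' e
          omega
    · rintro a (h' | ⟨r', hr', hc, h'⟩)
      · exact h'
      · rcases hlast r' hr' with rfl | e
        · exact h'
        · exact hH _ _ _ h' e
    · rintro a c (h' | ⟨r', hr', hc, h'⟩) - ih
      · exact hH _ _ _ h' ih
      · rcases hlast r' hr' with rfl | e
        · exact h'
        · exact hH _ _ _ h' e
  | succ m ihm =>
    intro r hr hc a ha
    rw [Function.iterate_succ_apply'] at ha
    have htr := fun a b c => History.iterate_saturate_trans (h := h) (K := K) hH (m + 1)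
      (a := a) (b := b) (c := c)
    have hpo' : ∀ r ∈ K, ∀ r' ∈ K, h.po r r' → ((h.saturate K)^[m + 1] H) r r' :=
      fun r hr r' hr' e => History.le_iterate_saturate (Nat.zero_le _) (hpo r hr r' hr' e)
    -- An edge forced by a read up to `r` starts below `r` already. An edge forced by a later read
    -- is not new, since the past of that read was settled one round earlier.
    have hstep : ∀ r' ∈ K, ∀ a c, h.Conflict a r' c → ((h.saturate K)^[m + 1] H) a r' →
        ((h.saturate K)^[m + 1] H) a r ∨ ((h.saturate K)^[m + 1] H) a c := by
      intro r' hr' a c hcf h'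
      rcases hK r' hr' r hr with rfl | e | e
      · exact .inl h'
      · exact .inl (htr _ _ _ h' (hpo' _ hr' _ hr e))
      · have hlt := History.laterCount_lt hr' e
        right
        have := ihm r' hr' (by omega) a h'
        rw [Function.iterate_succ_apply']
        exact .single (.inr ⟨r', hr', hcf, this⟩)
    refine Relation.TransGen.head_induction_on
      (motive := fun a _ => ((h.saturate K)^[m + 1] H) a r) ha ?_ ?_
    · rintro a (h' | ⟨r', hr', hcf, h'⟩)
      · exact h'
      · rcases hK r' hr' r hr with rfl | e | e
        · exact h'
        · exact htr _ _ _ h' (hpo' _ hr' _ hr e)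
        · exact (hstep r' hr' a r hcf h').elim id id
    · rintro a c (h' | ⟨r', hr', hcf, h'⟩) - ih
      · exact htr _ _ _ h' ih
      · exact (hstep r' hr' a c hcf h').elim id fun e => htr _ _ _ e ih

/-- At most `n - 1` elements come after `r`, so its past is settled after `n - 1` rounds and the
`n`-th round already adds every edge that `r` forces. -/
theorem History.forced_le_iterate_saturate {n : ℕ} {h : History (Fin n) RWMethod (RWData X)}
    {K : Set (Fin n)} {H : Fin n → Fin n → Prop} (hH : ∀ a b c, H a b → H b c → H a c)
    (hK : ∀ r ∈ K, ∀ r' ∈ K, r = r' ∨ h.po r r' ∨ h.po r' r)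
    (hpo : ∀ r ∈ K, ∀ r' ∈ K, h.po r r' → H r r') {a b : Fin n}
    (hab : h.Forced K ((h.saturate K)^[n] H) a b) : ((h.saturate K)^[n] H) a b := by
  obtain ⟨r, hr, hc, har⟩ := hab
  have hlt : h.laterCount K r < n := by
    have : {r' | h.po r r' ∧ r' ∈ K}.ncard < (Set.univ : Set (Fin n)).ncard :=
      Set.ncard_lt_ncard ⟨Set.subset_univ _, fun hs => h.po_strict.irrefl _ (hs trivial).1⟩
        (Set.toFinite _)
    rw [Set.ncard_univ, Nat.card_eq_fintype_card, Fintype.card_fin] at this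
    exact this
  obtain ⟨m, rfl⟩ : ∃ m, n = m + 1 := ⟨n - 1, by omega⟩
  have := History.saturate_settled hH hK hpo m r hr (by omega) a har
  rw [Function.iterate_succ_apply']
  exact .single (.inr ⟨r, hr, hc, this⟩)

theorem History.po_chain {O : Type u} {M : Type v} {D : Type w} (h : History O M D) (o : O) :
    ∀ r ∈ pastOf h.po o, ∀ r' ∈ pastOf h.po o, r = r' ∨ h.po r r' ∨ h.po r' r := by
  intro r hr r' hr'
  have h₁ : r = o ∨ h.po r o ∨ h.po o r := hr.elim (fun e => .inr (.inl e)) .inl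
  have h₂ : r' = o ∨ h.po r' o ∨ h.po o r' := hr'.elim (fun e => .inr (.inl e)) .inl
  exact h.po_sites.trans h₁ (h.po_sites.symm h₂)

/-- Every explaining order contains the saturation. Conversely, an acyclic saturation `H` is closed
under forcing, and it extends to a total order in which only operations `H`-below a read of `K`
precede that read. Thus the extension triggers no conflict that `H` has not resolved. -/
theorem isCM_iff {n : ℕ} {h : History (Fin n) RWMethod (RWData X)} (hrw : h.IsRW)
    (hd : h.Differentiated) :
    h.IsCM (rwMemory X) ↔ h.HasSources ∧
      ∀ o a, ¬ ((h.saturate (pastOf h.po o))^[n] (h.causalTo o)) a a := by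
  constructor
  · rintro ⟨co, hco, hpo, hρ⟩
    have hρ' : ∀ o, ∃ lt : Fin n → Fin n → Prop, IsStrictOrder (Fin n) lt ∧
        (∀ a ∈ pastOf co o, ∀ b ∈ pastOf co o, co a b → lt a b) ∧
        ∀ r ∈ pastOf co o, r ∈ pastOf h.po o → h.Respects lt (pastOf co o) r := by
      intro o
      obtain ⟨ρ, h₁, h₂⟩ := hρ o
      obtain ⟨lt, hlt, -, hR, hresp⟩ := h₂.exists_order hrw hd h₁
      exact ⟨lt, hlt, hR, hresp⟩
    obtain ⟨hsrc, hle⟩ := History.Respects.causal_le hd hco hpo fun o => by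
      obtain ⟨lt, h₁, -, h₂⟩ := hρ' o
      exact ⟨lt, h₁, h₂ o (.inr rfl) (.inr rfl)⟩
    refine ⟨hsrc, fun o => ?_⟩
    obtain ⟨lt, hlt, hR, hresp⟩ := hρ' o
    -- Membership of both ends in the past of `o` is carried along because the explaining order is
    -- constrained only there.
    have key : ∀ m a b, ((h.saturate (pastOf h.po o))^[m] (h.causalTo o)) a b →
        (a ∈ pastOf co o ∧ b ∈ pastOf co o) ∧ lt a b := by
      intro m
      induction m with
      | zero =>
        rintro a b ⟨hab, hb⟩
        have hb' : b ∈ pastOf co o := hb.imp (hle _ _) id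
        have ha' := mem_pastOf_of_rel hco.trans (hle _ _ hab) hb'
        exact ⟨⟨ha', hb'⟩, hR _ ha' _ hb' (hle _ _ hab)⟩
      | succ m ih =>
        intro a b hab
        rw [Function.iterate_succ_apply'] at hab
        refine transGen_le (S := fun a b => (a ∈ pastOf co o ∧ b ∈ pastOf co o) ∧ lt a b)
          (fun a b c h₁ h₂ => ⟨⟨h₁.1.1, h₂.1.2⟩, hlt.trans _ _ _ h₁.2 h₂.2⟩) ?_ hab
        rintro a b (hab | ⟨r, hr, hc, har⟩)
        · exact ih _ _ hab
        · obtain ⟨⟨ha, hr'⟩, hlt'⟩ := ih _ _ har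
          have hlt'' := (hresp r hr' hr).2 a ha hlt' b hc
          refine ⟨⟨ha, ?_⟩, hlt''⟩
          rcases hc.eq_or_readsFrom with rfl | hrf
          · exact ha
          · exact mem_pastOf_of_rel hco.trans (hle _ _ (.single (.inr hrf))) hr'
    exact fun a ha => hlt.irrefl _ (key n a a ha).2
  · rintro ⟨hsrc, hirr⟩
    have hco : IsStrictOrder (Fin n) h.causal := isStrictOrder_transGen fun a ha =>
      hirr a a (History.le_iterate_saturate (Nat.zero_le n) ⟨ha, .inr rfl⟩)
    have hpoc : ∀ a b, h.po a b → h.causal a b := fun a b hab => .single (.inl hab)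
    refine ⟨h.causal, hco, hpoc, fun o => ?_⟩
    generalize hK : pastOf h.po o = K at *
    have hH₀ : ∀ a b c, h.causalTo o a b → h.causalTo o b c → h.causalTo o a c :=
      fun a b c h₁ h₂ => ⟨h₁.1.trans h₂.1, h₂.2⟩
    have hKpast : ∀ r ∈ K, r ∈ pastOf h.causal o := by
      rw [← hK]
      exact fun r hr => hr.imp (hpoc _ _) id
    have hchain : ∀ r ∈ K, ∀ r' ∈ K, r = r' ∨ h.po r r' ∨ h.po r' r := hK ▸ h.po_chain o
    have hpo₀ : ∀ r ∈ K, ∀ r' ∈ K, h.po r r' → h.causalTo o r r' :=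
      fun r _ r' hr' e => ⟨hpoc _ _ e, hKpast r' hr'⟩
    have hcl := fun a b => History.forced_le_iterate_saturate hH₀ hchain hpo₀ (a := a) (b := b)
    have htr := fun a b c => History.iterate_saturate_trans (h := h) (K := K) hH₀ n
      (a := a) (b := b) (c := c)
    have hle : ∀ a b, h.causalTo o a b → ((h.saturate K)^[n] (h.causalTo o)) a b :=
      fun a b hab => History.le_iterate_saturate (m := 0) (Nat.zero_le n) hab
    have hirr := hK ▸ hirr o
    generalize (h.saturate K)^[n] (h.causalTo o) = H at *
    obtain ⟨lt, hlt, hHlt, hf⟩ := exists_total_extension (R := H)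
      { irrefl := hirr, trans := htr }
      -- Counts the elements of `K` that `a` is not at or below. As `K` is an `H`-chain, an
      -- operation not at or below `r ∈ K` has a strictly larger count than `r`, hence comes after
      -- it.
      (fun a => {r | r ∈ K ∧ ¬ (a = r ∨ H a r)}.ncard) (by
        intro a b hab
        refine Set.ncard_le_ncard (fun r hr => ⟨hr.1, fun hb => hr.2 (.inr ?_)⟩) (Set.toFinite _)
        rcases hb with rfl | hb
        · exact hab
        · exact htr _ _ _ hab hb)
    have hcolt : ∀ a, ∀ b ∈ pastOf h.causal o, h.causal a b → lt a b :=
      fun a b hb hab => hHlt _ _ (hle _ _ ⟨hab, hb⟩)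
    refine exists_sequencedBy hrw (lt := lt) (fun a _ b hb hab => hcolt a b hb hab) ?_
    intro r hr hrK
    refine ⟨fun hn => ?_, fun w₁ hw₁ hlt₁ w₂ hc => ?_⟩
    · obtain ⟨w, hw⟩ := hsrc r hn
      have : h.causal w r := .single (.inr hw)
      exact ⟨w, mem_pastOf_of_rel hco.trans this hr, hcolt _ _ hr this, hw⟩
    · refine hHlt _ _ (hcl _ _ ⟨r, hrK, hc, ?_⟩)
      by_contra hno
      have hne : w₁ ≠ r := by
        rintro rfl
        exact hlt.irrefl _ hlt₁
      refine hlt.irrefl _ (hlt.trans _ _ _ hlt₁ (hf _ _ (Set.ncard_lt_ncard ⟨?_, fun hs => ?_⟩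
        (Set.toFinite _))))
      · rintro r' ⟨hr', hr''⟩
        refine ⟨hr', fun hw => hno ?_⟩
        have hr'r : H r' r := by
          rcases hchain r' hr' r hrK with rfl | e | e
          · exact (hr'' (.inl rfl)).elim
          · exact hle _ _ (hpo₀ _ hr' _ hrK e)
          · exact (hr'' (.inr (hle _ _ (hpo₀ _ hrK _ hr' e)))).elim
        rcases hw with rfl | hw
        · exact hr'r
        · exact htr _ _ _ hw hr'r
      · exact (hs (a := r) ⟨hrK, fun e => e.elim hne hno⟩).2 (.inl rfl)

end Characterisation

/-! ### A language of relational programs, and its compilation to random access programs -/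

/-- The operations of a history, with numbers for their methods, variables and values. -/
structure OpTable (n : ℕ) where
  kind : Fin n → ℕ
  var : Fin n → ℕ
  val : Fin n → ℕ
  po : Fin n → Fin n → Prop

/-- A family of binary relations on `Fin n`. -/
abbrev RelStore (n : ℕ) : Type := ℕ → Fin n → Fin n → Prop

/-- Quantifier-free formulas about the operations named by the variables `i`, `j`. -/
inductive RelFormula where
  | rel (m i j : ℕ)
  | po (i j : ℕ)
  | isWrite (i : ℕ)
  | sameVar (i j : ℕ)
  | sameVal (i j : ℕ)
  | isZero (i : ℕ)
  | eq (i j : ℕ)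
  | not (f : RelFormula)
  | and (f g : RelFormula)
  | or (f g : RelFormula)

def RelFormula.Holds {n : ℕ} (D : OpTable n) (σ : RelStore n) (ρ : ℕ → Fin n) : RelFormula → Prop
  | .rel m i j => σ m (ρ i) (ρ j)
  | .po i j => D.po (ρ i) (ρ j)
  | .isWrite i => D.kind (ρ i) = 0
  | .sameVar i j => D.var (ρ i) = D.var (ρ j)
  | .sameVal i j => D.val (ρ i) = D.val (ρ j)
  | .isZero i => D.val (ρ i) = 0
  | .eq i j => ρ i = ρ j
  | .not f => ¬ f.Holds D σ ρ
  | .and f g => f.Holds D σ ρ ∧ g.Holds D σ ρ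
  | .or f g => f.Holds D σ ρ ∨ g.Holds D σ ρ

/-- Relational programs. `set m f` redefines the relation `m` by the formula `f`, `each p` runs `p`
once for every operation. Variables are numbered by the nesting depth of their binders; `set` binds
two of them, the row and the column. -/
inductive RelProg where
  | set (m : ℕ) (f : RelFormula)
  | seq (p q : RelProg)
  | each (p : RelProg)

/-- Apply `f 0`, `f 1`, …, `f (k - 1)` one after the other. -/
def iterFin {α : Type*} {n : ℕ} (f : Fin n → α → α) (a : α) : ℕ → α
  | 0 => a
  | k + 1 => if hk : k < n then f ⟨k, hk⟩ (iterFin f a k) else iterFin f a k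

theorem iterFin_succ {α : Type*} {n : ℕ} (f : Fin n → α → α) (a : α) (k : Fin n) :
    iterFin f a (k + 1) = f k (iterFin f a k) := by
  simp [iterFin, k.2]

def RelProg.sem {n : ℕ} (D : OpTable n) : RelProg → ℕ → (ℕ → Fin n) → RelStore n → RelStore n
  | .set m f, d, ρ, σ => Function.update σ m fun i j =>
      f.Holds D σ (Function.update (Function.update ρ d i) (d + 1) j)
  | .seq p q, d, ρ, σ => q.sem D d ρ (p.sem D d ρ σ)
  | .each p, d, ρ, σ => iterFin (fun k σ => p.sem D (d + 1) (Function.update ρ d k) σ) σ n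

/-- The degree of the running time. -/
def RelProg.degree : RelProg → ℕ
  | .set _ _ => 2
  | .seq p q => max p.degree q.degree
  | .each p => p.degree + 1

/-- The position of the entry of a matrix, given by two variables. Array `4` is to hold the
positions of the first entries of the rows. -/
def entryExpr (i j : ℕ) : RamExpr := .add (.get 4 (.reg (i + 1))) (.reg (j + 1))

/-- Variable `v` lives in register `v + 1`, since register `0` holds `n`, and relation `m` in array
`m + 6`. Truth values are `0` and `1`, so connectives are comparisons of sums. -/
def RelFormula.expr : RelFormula → RamExpr
  | .rel m i j => .get (m + 6) (entryExpr i j)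
  | .po i j => .get 3 (entryExpr i j)
  | .isWrite i => .eq (.get 0 (.reg (i + 1))) (.const 0)
  | .sameVar i j => .eq (.get 1 (.reg (i + 1))) (.get 1 (.reg (j + 1)))
  | .sameVal i j => .eq (.get 2 (.reg (i + 1))) (.get 2 (.reg (j + 1)))
  | .isZero i => .eq (.get 2 (.reg (i + 1))) (.const 0)
  | .eq i j => .eq (.reg (i + 1)) (.reg (j + 1))
  | .not f => .eq f.expr (.const 0)
  | .and f g => .lt (.const 1) (.add f.expr g.expr)
  | .or f g => .lt (.const 0) (.add f.expr g.expr)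

/-- Run `p` for all values of variable `d` below `n`. -/
def RamProg.forLoop (d : ℕ) (p : RamProg) : RamProg :=
  .seq (.loop (.lt (.reg (d + 1)) (.reg 0))
    (.seq p (.assign (d + 1) (.add (.reg (d + 1)) (.const 1))))) (.assign (d + 1) (.const 0))

/-- Fill array `A`, as a matrix, with the values of `e`. -/
def RamProg.fill (d A : ℕ) (e : RamExpr) : RamProg :=
  .forLoop d (.forLoop (d + 1) (.store A (entryExpr d (d + 1)) e))

/-- Array `5` is a scratch copy: the formula may mention the relation being redefined, and must see
only its old entries. -/
def RelProg.compile : RelProg → ℕ → RamProg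
  | .set m f, d =>
      .seq (.fill d 5 f.expr) (.fill d (m + 6) (.get 5 (entryExpr d (d + 1))))
  | .seq p q, d => .seq (p.compile d) (q.compile d)
  | .each p, d => .forLoop d (p.compile (d + 1))

/-! ### Correctness and running time of compiled programs. -/

/-- Resetting the counter at the end restores all registers, so an enclosing loop can run the same
code again. Test and increment cost 4 steps each per iteration; the last test and the reset cost 6.
-/
theorem RamProg.run_forLoop {d n T : ℕ} {p : RamProg} {reg : ℕ → ℕ} {a : ℕ → ℕ → ℕ}
    (I : ℕ → (ℕ → ℕ → ℕ) → Prop) (h₀ : reg 0 = n) (hd : reg (d + 1) = 0) (ha : I 0 a)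
    (hbody : ∀ k < n, ∀ a, I k a → ∃ a' t,
      Run p ⟨Function.update reg (d + 1) k, a⟩ ⟨Function.update reg (d + 1) k, a'⟩ t ∧ t ≤ T ∧
        I (k + 1) a') :
    ∃ a' t, Run (.forLoop d p) ⟨reg, a⟩ ⟨reg, a'⟩ t ∧ t ≤ n * (T + 8) + 6 ∧ I n a' := by
  have key : ∀ m k a, k + m = n → I k a → ∃ a' t,
      Run (.loop (.lt (.reg (d + 1)) (.reg 0))
        (.seq p (.assign (d + 1) (.add (.reg (d + 1)) (.const 1)))))
        ⟨Function.update reg (d + 1) k, a⟩ ⟨Function.update reg (d + 1) n, a'⟩ t ∧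
        t ≤ m * (T + 8) + 4 ∧ I n a' := by
    intro m
    induction m with
    | zero =>
      rintro k a rfl hk
      refine ⟨a, _, .loop_false _ _ _ ?_, ?_, hk⟩
      · simp [RamExpr.eval, Function.update, h₀]
      · simp [RamExpr.cost]
    | succ m ih =>
      intro k a e hk
      obtain ⟨a₁, t₁, hr₁, ht₁, hI₁⟩ := hbody k (by omega) a hk
      obtain ⟨a₂, t₂, hr₂, ht₂, hI₂⟩ := ih (k + 1) a₁ (by omega) hI₁
      refine ⟨a₂, _, .loop_true _ _ _ _ _ _ t₂ ?_ (.seq _ _ _ _ _ _ _ hr₁ (.assign _ _ _)) ?_,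
        ?_, hI₂⟩
      · have : k < n := by omega
        simp [RamExpr.eval, Function.update, h₀, this]
      · simpa [RamExpr.eval] using hr₂
      · simp only [RamExpr.cost]
        have : (m + 1) * (T + 8) = m * (T + 8) + (T + 8) := by ring
        omega
  obtain ⟨a', t, hr, ht, hI⟩ := key n 0 a (by omega) ha
  have e₀ : Function.update reg (d + 1) 0 = reg := by
    rw [← hd, Function.update_eq_self]
  refine ⟨a', _, .seq _ _ _ _ _ t 2 (e₀ ▸ hr) ?_, ?_, hI⟩
  · have := Run.assign (d + 1) (.const 0) ⟨Function.update reg (d + 1) n, a'⟩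
    simpa [RamExpr.eval, RamExpr.cost, e₀] using this
  · omega

theorem entry_inj {n i j i' j' : ℕ} (hj : j < n) (hj' : j' < n)
    (e : i * n + j = i' * n + j') : i = i' ∧ j = j' := by
  have hn : 0 < n := by omega
  have h₁ : (i * n + j) / n = i := by
    rw [mul_comm, Nat.mul_add_div hn, Nat.div_eq_of_lt hj, add_zero]
  have h₂ : (i' * n + j') / n = i' := by
    rw [mul_comm, Nat.mul_add_div hn, Nat.div_eq_of_lt hj', add_zero]
  obtain rfl : i = i' := by rw [← h₁, e, h₂]
  exact ⟨rfl, by omega⟩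

/-- The registers hold `n` and the variables `ρ`. -/
def RegsHold {n : ℕ} (ρ : ℕ → Fin n) (reg : ℕ → ℕ) : Prop :=
  reg 0 = n ∧ ∀ v, reg (v + 1) = ρ v

theorem RegsHold.update {n : ℕ} {ρ : ℕ → Fin n} {reg : ℕ → ℕ} (h : RegsHold ρ reg) (d : ℕ)
    (k : Fin n) : RegsHold (Function.update ρ d k) (Function.update reg (d + 1) k) := by
  refine ⟨by simp [h.1], fun v => ?_⟩
  by_cases hv : v = d
  · subst hv
    simp
  · simp [hv, h.2]

open Classical in
/-- The arrays hold the table `D`, the row positions and the relations `σ`. -/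
def ArraysHold {n : ℕ} (D : OpTable n) (σ : RelStore n) (a : ℕ → ℕ → ℕ) : Prop :=
  (∀ i : Fin n, a 0 i = D.kind i ∧ a 1 i = D.var i ∧ a 2 i = D.val i ∧ a 4 i = i * n) ∧
    (∀ i j : Fin n, a 3 (i * n + j) = if D.po i j then 1 else 0) ∧
      ∀ m, ∀ i j : Fin n, a (m + 6) (i * n + j) = if σ m i j then 1 else 0

/-- The value of `e` must not depend on array `A`, whose entries change during the loop. -/
theorem RamProg.run_fill {n d A : ℕ} {e : RamExpr} {ρ : ℕ → Fin n} {reg : ℕ → ℕ}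
    {a : ℕ → ℕ → ℕ} (g : Fin n → Fin n → ℕ) (hreg : RegsHold ρ reg)
    (hd : (ρ d).val = 0) (hd' : (ρ (d + 1)).val = 0)
    (ha : ∀ i : Fin n, a 4 i = i * n) (hA : A ≠ 4)
    (hg : ∀ i j : Fin n, ∀ a', (∀ B ≠ A, a' B = a B) →
      e.eval ⟨Function.update (Function.update reg (d + 1) i) (d + 2) j, a'⟩ = g i j) :
    ∃ a' t, Run (.fill d A e) ⟨reg, a⟩ ⟨reg, a'⟩ t ∧
      t ≤ n * (n * (e.cost + 5 + 8) + 6 + 8) + 6 ∧ (∀ B ≠ A, a' B = a B) ∧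
        ∀ i j : Fin n, a' A (i * n + j) = g i j := by
  obtain ⟨a', t, hr, ht, hB, hI⟩ := run_forLoop (d := d) (n := n) (reg := reg) (a := a)
    (T := n * (e.cost + 5 + 8) + 6)
    (p := .forLoop (d + 1) (.store A (entryExpr d (d + 1)) e))
    (fun k a' => (∀ B ≠ A, a' B = a B) ∧
      ∀ i j : Fin n, i.val < k → a' A (i * n + j) = g i j)
    hreg.1 (by rw [hreg.2, hd]) ⟨fun _ _ => rfl, fun _ _ h => by omega⟩ (by
      intro k hk a₁ ⟨h₁, h₂⟩
      obtain ⟨a', t, hr, ht, hB, hI, hI'⟩ := run_forLoop (d := d + 1) (n := n)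
        (reg := Function.update reg (d + 1) k) (a := a₁)
        (T := e.cost + 5) (p := .store A (entryExpr d (d + 1)) e)
        (fun l a' => (∀ B ≠ A, a' B = a B) ∧
          (∀ i j : Fin n, i.val < k → a' A (i * n + j) = g i j) ∧
          ∀ j : Fin n, j.val < l → a' A (k * n + j) = g ⟨k, hk⟩ j)
        (by simp [hreg.1]) (by simp [hreg.2, hd']) ⟨h₁, h₂, fun _ h => by omega⟩ (by
          intro l hl a₂ ⟨k₁, k₂, k₃⟩
          refine ⟨_, _, .store _ _ _ _, ?_, ?_, ?_, ?_⟩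
          · simp [RamExpr.cost, entryExpr]
            omega
          · intro B hB
            simp [hB, k₁ B hB]
          all_goals
            have hidx : (entryExpr d (d + 1)).eval
                ⟨Function.update (Function.update reg (d + 1) k) (d + 1 + 1) l, a₂⟩
                  = k * n + l := by
              simp [entryExpr, RamExpr.eval, Function.update, k₁ 4 hA.symm, ha ⟨k, hk⟩]
            have hval := hg ⟨k, hk⟩ ⟨l, hl⟩ a₂ k₁
          · intro i j hi
            simp only [hidx, Function.update_self]
            rw [Function.update_of_ne, k₂ i j hi]
            intro e
            have := (entry_inj j.2 hl e).1
            omega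
          · intro j hj
            simp only [hidx, Function.update_self]
            by_cases e : j.val = l
            · subst e
              simpa using hval
            · rw [Function.update_of_ne, k₃ j (by omega)]
              intro e'
              exact e (entry_inj j.2 hl e').2)
      refine ⟨a', t, hr, ht, hB, fun i j hi => ?_⟩
      rcases Nat.lt_succ_iff_lt_or_eq.1 hi with hi | hi
      · exact hI i j hi
      · obtain rfl : i = ⟨k, hk⟩ := Fin.ext hi
        exact hI' j j.2)
  exact ⟨a', t, hr, ht, hB, fun i j => hI i j i.2⟩

open Classical in
theorem RelFormula.eval_expr {n : ℕ} {D : OpTable n} {σ : RelStore n} {ρ : ℕ → Fin n}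
    {reg : ℕ → ℕ} {a : ℕ → ℕ → ℕ} (ha : ArraysHold D σ a) (hreg : RegsHold ρ reg)
    (f : RelFormula) : f.expr.eval ⟨reg, a⟩ = if f.Holds D σ ρ then 1 else 0 := by
  obtain ⟨h₁, h₂, h₃⟩ := ha
  have hv := hreg.2
  induction f with
  | rel m i j => simp [expr, Holds, entryExpr, RamExpr.eval, hv, h₁, h₃]; congr
  | po i j => simp [expr, Holds, entryExpr, RamExpr.eval, hv, h₁, h₂]; congr
  | isWrite i => simp [expr, Holds, RamExpr.eval, hv, h₁]; congr
  | sameVar i j => simp [expr, Holds, RamExpr.eval, hv, h₁]; congr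
  | sameVal i j => simp [expr, Holds, RamExpr.eval, hv, h₁]; congr
  | isZero i => simp [expr, Holds, RamExpr.eval, hv, h₁]; congr
  | eq i j => simp [expr, Holds, RamExpr.eval, hv, Fin.ext_iff]
  | not f ih =>
    simp only [expr, Holds, RamExpr.eval, ih]
    by_cases h : f.Holds D σ ρ <;> simp [h]
  | and f g ih₁ ih₂ =>
    simp only [expr, Holds, RamExpr.eval, ih₁, ih₂]
    by_cases h : f.Holds D σ ρ <;> by_cases h' : g.Holds D σ ρ <;> simp [h, h']
  | or f g ih₁ ih₂ =>
    simp only [expr, Holds, RamExpr.eval, ih₁, ih₂]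
    by_cases h : f.Holds D σ ρ <;> by_cases h' : g.Holds D σ ρ <;> simp [h, h']

theorem ArraysHold.congr {n : ℕ} {D : OpTable n} {σ : RelStore n} {a a' : ℕ → ℕ → ℕ}
    (ha : ArraysHold D σ a) (h : ∀ B ≠ 5, a' B = a B) : ArraysHold D σ a' := by
  obtain ⟨h₁, h₂, h₃⟩ := ha
  refine ⟨fun i => ?_, fun i j => ?_, fun m i j => ?_⟩
  · rw [h 0 (by omega), h 1 (by omega), h 2 (by omega), h 4 (by omega)]
    exact h₁ i
  · rw [h 3 (by omega), h₂]
  · rw [h (m + 6) (by omega), h₃]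

/-- Compiled programs are correct, and run in polynomial time. -/
theorem RelProg.run_compile (p : RelProg) : ∀ d, ∃ C, ∀ (n : ℕ) (D : OpTable n) (ρ : ℕ → Fin n)
    (σ : RelStore n) (reg : ℕ → ℕ) (a : ℕ → ℕ → ℕ), (∀ v ≥ d, (ρ v).val = 0) → RegsHold ρ reg →
    ArraysHold D σ a → ∃ a' t, RamProg.Run (p.compile d) ⟨reg, a⟩ ⟨reg, a'⟩ t ∧
      t ≤ C * n ^ p.degree ∧ ArraysHold D (p.sem D d ρ σ) a' := by
  classical
  induction p with
  | set m f =>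
    intro d
    refine ⟨2 * (f.expr.cost + 50), fun n D ρ σ reg a hρ hreg ha => ?_⟩
    have hn : 0 < n := (ρ 0).pos
    obtain ⟨a₁, t₁, hr₁, ht₁, hB₁, hv₁⟩ := RamProg.run_fill (d := d) (A := 5) (e := f.expr)
      (fun i j => if f.Holds D σ (Function.update (Function.update ρ d i) (d + 1) j) then 1 else 0)
      hreg (hρ d le_rfl) (hρ (d + 1) (by omega)) (fun i => (ha.1 i).2.2.2) (by omega)
      (fun i j a' h' => RelFormula.eval_expr (ha.congr h') ((hreg.update d i).update (d + 1) j) f)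
    have ha₁ := ha.congr hB₁
    obtain ⟨a₂, t₂, hr₂, ht₂, hB₂, hv₂⟩ := RamProg.run_fill (d := d) (A := m + 6)
      (e := .get 5 (entryExpr d (d + 1)))
      (fun i j => if f.Holds D σ (Function.update (Function.update ρ d i) (d + 1) j) then 1 else 0)
      hreg (hρ d le_rfl) (hρ (d + 1) (by omega)) (fun i => (ha₁.1 i).2.2.2) (by omega)
      (fun i j a' h' => by
        rw [← hv₁ i j]
        simp [entryExpr, RamExpr.eval, Function.update, h' 4 (by omega), h' 5 (by omega),
          (ha₁.1 i).2.2.2])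
    refine ⟨a₂, _, .seq _ _ _ _ _ _ _ hr₁ hr₂, ?_, ?_⟩
    · simp only [RamExpr.cost, entryExpr, degree] at *
      nlinarith [Nat.mul_le_mul hn hn, Nat.mul_le_mul_left n hn]
    · obtain ⟨h₁, h₂, h₃⟩ := ha₁
      refine ⟨fun i => ?_, fun i j => ?_, fun m' i j => ?_⟩
      · rw [hB₂ 0 (by omega), hB₂ 1 (by omega), hB₂ 2 (by omega), hB₂ 4 (by omega)]
        exact h₁ i
      · rw [hB₂ 3 (by omega), h₂]
      · by_cases e : m' = m
        · subst e
          rw [hv₂]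
          simp [sem]
        · rw [hB₂ (m' + 6) (by omega), h₃]
          simp [sem, e]
  | seq p q ihp ihq =>
    intro d
    obtain ⟨C₁, h₁⟩ := ihp d
    obtain ⟨C₂, h₂⟩ := ihq d
    refine ⟨C₁ + C₂, fun n D ρ σ reg a hρ hreg ha => ?_⟩
    have hn : 0 < n := (ρ 0).pos
    obtain ⟨a₁, t₁, hr₁, ht₁, ha₁⟩ := h₁ n D ρ σ reg a hρ hreg ha
    obtain ⟨a₂, t₂, hr₂, ht₂, ha₂⟩ := h₂ n D ρ _ reg a₁ hρ hreg ha₁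
    refine ⟨a₂, _, .seq _ _ _ _ _ _ _ hr₁ hr₂, ?_, ha₂⟩
    have e₁ := Nat.mul_le_mul_left C₁ (Nat.pow_le_pow_right hn (le_max_left p.degree q.degree))
    have e₂ := Nat.mul_le_mul_left C₂ (Nat.pow_le_pow_right hn (le_max_right p.degree q.degree))
    simp only [degree]
    rw [add_mul]
    omega
  | each p ih =>
    intro d
    obtain ⟨C, h⟩ := ih (d + 1)
    refine ⟨C + 14, fun n D ρ σ reg a hρ hreg ha => ?_⟩
    have hn : 0 < n := (ρ 0).pos
    obtain ⟨a', t, hr, ht, ha'⟩ := RamProg.run_forLoop (d := d) (n := n) (reg := reg) (a := a)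
      (p := p.compile (d + 1)) (T := C * n ^ p.degree)
      (fun k a => ArraysHold D
        (iterFin (fun k σ => p.sem D (d + 1) (Function.update ρ d k) σ) σ k) a)
      hreg.1 (by rw [hreg.2, hρ d le_rfl]) ha (by
        intro k hk a ha
        have := h n D (Function.update ρ d ⟨k, hk⟩) _ _ a (fun v hv => by
          rw [Function.update_of_ne (by omega)]
          exact hρ v (by omega)) (hreg.update d ⟨k, hk⟩) ha
        rwa [← iterFin_succ (fun k σ => p.sem D (d + 1) (Function.update ρ d k) σ) σ
          ⟨k, hk⟩] at this)
    refine ⟨a', t, hr, ht.trans ?_, ha'⟩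
    have h₁ : n ≤ n ^ (p.degree + 1) := Nat.le_self_pow (by omega) n
    have h₂ : n * (C * n ^ p.degree) = C * n ^ (p.degree + 1) := by ring
    simp only [degree]
    rw [mul_add, h₂, add_mul]
    omega

/-! ### Deciding the three criteria -/

theorem iterFin_induction {α : Type*} {n : ℕ} {f : Fin n → α → α} {a : α} (P : ℕ → α → Prop)
    (h₀ : P 0 a) (hs : ∀ (k : Fin n) x, P k x → P (k + 1) (f k x)) : P n (iterFin f a n) := by
  have key : ∀ k ≤ n, P k (iterFin f a k) := by
    intro k
    induction k with
    | zero => exact fun _ => h₀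
    | succ k ih =>
      intro hk
      rw [iterFin_succ f a ⟨k, hk⟩]
      exact hs ⟨k, hk⟩ _ (ih (by omega))
  exact key n le_rfl

/-- Add to the relation `m` all pairs that satisfy `f` for some value of the variable `d`. -/
def RelProg.union (m : ℕ) (f : RelFormula) (d : ℕ) : RelProg :=
  .each (.set m (.or (.rel m (d + 1) (d + 2)) f))

/-- The formula must be insensitive to relation `m`, which grows as the loop proceeds. -/
theorem RelProg.sem_union {n : ℕ} {D : OpTable n} {m : ℕ} {f : RelFormula} {d : ℕ}
    {ρ : ℕ → Fin n} {σ : RelStore n}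
    (hf : ∀ R ρ, f.Holds D (Function.update σ m R) ρ ↔ f.Holds D σ ρ) :
    (union m f d).sem D d ρ σ = Function.update σ m fun i j => σ m i j ∨ ∃ k, f.Holds D σ
      (Function.update (Function.update (Function.update ρ d k) (d + 1) i) (d + 2) j) := by
  have key := iterFin_induction (n := n) (a := σ)
    (f := fun k σ => (RelProg.set m (.or (.rel m (d + 1) (d + 2)) f)).sem D (d + 1)
      (Function.update ρ d k) σ)
    (fun l τ => τ = Function.update σ m fun i j => σ m i j ∨ ∃ k : Fin n, k.val < l ∧ f.Holds D σ
      (Function.update (Function.update (Function.update ρ d k) (d + 1) i) (d + 2) j))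
    (by simp) (by
      rintro k τ rfl
      simp only [sem, RelFormula.Holds, Function.update_self, hf, Function.update_idem]
      congr 1
      funext i j
      simp only [Nat.lt_succ_iff_lt_or_eq, Function.update_of_ne (show d + 1 ≠ d + 2 by omega),
        Function.update_self, or_and_right, exists_or, or_assoc]
      simp [← Fin.ext_iff])
  simpa [union, sem] using key

/-- Warshall's algorithm. -/
def RelProg.transClose (m d : ℕ) : RelProg :=
  .each (.set m (.or (.rel m (d + 1) (d + 2)) (.and (.rel m (d + 1) d) (.rel m d (d + 2)))))

theorem RelProg.sem_transClose {n : ℕ} {D : OpTable n} {m d : ℕ} {ρ : ℕ → Fin n}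
    {σ : RelStore n} :
    (transClose m d).sem D d ρ σ = Function.update σ m (Relation.TransGen (σ m)) := by
  obtain ⟨R, h₁, h₂, h₃, h₄⟩ := iterFin_induction (n := n) (a := σ)
    (f := fun k σ => (RelProg.set m (.or (.rel m (d + 1) (d + 2))
      (.and (.rel m (d + 1) d) (.rel m d (d + 2))))).sem D (d + 1) (Function.update ρ d k) σ)
    -- Warshall's invariant: `R` lies between the relation and its closure and is transitive through
    -- intermediate points below `l`.
    (fun l τ => ∃ R : Fin n → Fin n → Prop, τ = Function.update σ m R ∧
      (∀ a b, σ m a b → R a b) ∧ (∀ a b, R a b → Relation.TransGen (σ m) a b) ∧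
      ∀ a b c, c.val < l → R a c → R c b → R a b)
    ⟨σ m, by simp, fun _ _ e => e, fun _ _ e => .single e, fun _ _ _ e => by omega⟩ (by
      rintro k τ ⟨R, rfl, h₁, h₂, h₃⟩
      refine ⟨fun i j => R i j ∨ R i k ∧ R k j, ?_, fun a b e => .inl (h₁ _ _ e), ?_, ?_⟩
      · simp [sem, RelFormula.Holds, Function.update, show d ≠ d + 1 + 1 by omega]
      · rintro a b (e | ⟨e, e'⟩)
        · exact h₂ _ _ e
        · exact (h₂ _ _ e).trans (h₂ _ _ e')
      · intro a b c hc hac hcb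
        rcases Nat.lt_succ_iff_lt_or_eq.1 hc with hc | hc
        · rcases hac with hac | ⟨hac, hac'⟩ <;> rcases hcb with hcb | ⟨hcb, hcb'⟩
          · exact .inl (h₃ _ _ _ hc hac hcb)
          · exact .inr ⟨h₃ _ _ _ hc hac hcb, hcb'⟩
          · exact .inr ⟨hac, h₃ _ _ _ hc hac' hcb⟩
          · exact .inr ⟨hac, hcb'⟩
        · obtain rfl : c = k := Fin.ext hc
          exact .inr ⟨hac.elim id And.left, hcb.elim id And.right⟩)
  have hR : R = Relation.TransGen (σ m) := by
    funext a b
    refine propext ⟨h₃ a b, fun e => transGen_le (fun a c b => h₄ a b c c.2) h₂ e⟩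
  simpa [transClose, sem, hR] using h₁

/-- The table of the operations of a history. -/
def History.table {X : Type u} {n : ℕ} (h : History (Fin n) RWMethod (RWData X)) (name : X → ℕ) :
    OpTable n where
  kind i := methodCode (h.label i)
  var i := varCode name (h.label i)
  val i := valueCode (h.label i)
  po := h.po

def RelFormula.readsFrom (i j : ℕ) : RelFormula :=
  .and (.isWrite i) (.and (.not (.isWrite j)) (.and (.sameVar i j) (.sameVal i j)))

def RelFormula.needsSource (i : ℕ) : RelFormula := .and (.not (.isWrite i)) (.not (.isZero i))

def RelFormula.conflict (i k j : ℕ) : RelFormula :=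
  .and (.isWrite i) (.and (.not (.isWrite k)) (.and (.sameVar i k)
    (.or (.and (.readsFrom j k) (.not (.eq i j))) (.and (.isZero k) (.eq j i)))))

section Formulas

variable {X : Type u} {n : ℕ} {h : History (Fin n) RWMethod (RWData X)} {name : X → ℕ}
  {σ : RelStore n} {ρ : ℕ → Fin n}

theorem History.label_cases (hrw : h.IsRW) (o : Fin n) : ∃ x ∈ h.vars, ∃ v,
    h.label o = wrLabel x v ∨ h.label o = rdLabel x v := by
  obtain ⟨x, v, e⟩ := hrw o
  exact ⟨x, ⟨o, v, e⟩, v, e⟩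

theorem RelFormula.holds_readsFrom (hrw : h.IsRW) (hname : Set.InjOn name h.vars) (i j : ℕ) :
    (readsFrom i j).Holds (h.table name) σ ρ ↔ h.ReadsFrom (ρ i) (ρ j) := by
  obtain ⟨x, hx, v, hi⟩ := History.label_cases hrw (ρ i)
  obtain ⟨y, hy, w, hj⟩ := History.label_cases hrw (ρ j)
  have hxy : name x = name y ↔ x = y := ⟨fun e => hname hx hy e, fun e => e ▸ rfl⟩
  simp only [readsFrom, Holds, History.table, History.ReadsFrom]
  rcases hi with hi | hi <;> rcases hj with hj | hj <;> rw [hi, hj] <;>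
    simp [wrLabel, rdLabel, methodCode, varCode, valueCode, hxy]

theorem RelFormula.holds_needsSource (hrw : h.IsRW) (i : ℕ) :
    (needsSource i).Holds (h.table name) σ ρ ↔ h.NeedsSource (ρ i) := by
  obtain ⟨x, hx, v, hi⟩ := History.label_cases hrw (ρ i)
  simp only [needsSource, Holds, History.table, History.NeedsSource]
  rcases hi with hi | hi <;> rw [hi] <;> simp [wrLabel, rdLabel, methodCode, valueCode]

theorem RelFormula.holds_conflict (hrw : h.IsRW) (hname : Set.InjOn name h.vars) (i k j : ℕ) :
    (conflict i k j).Holds (h.table name) σ ρ ↔ h.Conflict (ρ i) (ρ k) (ρ j) := by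
  obtain ⟨x, hx, v, hi⟩ := History.label_cases hrw (ρ i)
  obtain ⟨y, hy, w, hk⟩ := History.label_cases hrw (ρ k)
  have hxy : name x = name y ↔ x = y := ⟨fun e => hname hx hy e, fun e => e ▸ rfl⟩
  simp only [conflict, Holds, holds_readsFrom hrw hname]
  simp only [History.table, History.ReadsFrom, History.Conflict]
  rcases hi with hi | hi <;> rcases hk with hk | hk <;> rw [hi, hk] <;>
    simp [wrLabel, rdLabel, methodCode, varCode, valueCode, hxy]

end Formulas

namespace RelProg

/-- Relation `0` becomes the causal order; relation `2` holds in the rows of the reads that have no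
source. -/
def prepare : RelProg :=
  .seq (.set 0 (.or (.po 0 1) (.readsFrom 0 1)))
    (.seq (transClose 0 0)
      (.seq (union 1 (.readsFrom 0 1) 0)
        (.set 2 (.and (.needsSource 0) (.not (.rel 1 0 1))))))

/-- Relation `6` becomes full if relation `2` is nonempty, and empty otherwise. -/
def conclude : RelProg := .seq (union 5 (.rel 2 0 2) 0) (union 6 (.rel 5 1 0) 0)

def searchCC : RelProg :=
  .seq (union 2 (.and (.conflict 1 0 2) (.and (.rel 0 1 0) (.or (.eq 1 2) (.rel 0 2 1)))) 0)
    (.set 2 (.or (.rel 2 0 1) (.rel 0 0 0)))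

def searchCCv : RelProg :=
  .seq (.set 3 (.rel 0 0 1))
    (.seq (union 3 (.and (.conflict 1 0 2) (.rel 0 1 0)) 0)
      (.seq (transClose 3 0) (.set 2 (.or (.rel 2 0 1) (.rel 3 0 0)))))

/-- One round of the saturation of relation `3` for the operation in variable `0`. -/
def saturateRound : RelProg :=
  .seq (.set 4 (.rel 3 2 3))
    (.seq (union 4 (.and (.conflict 3 2 4) (.and (.rel 3 3 2) (.or (.po 2 0) (.eq 2 0)))) 2)
      (.seq (transClose 4 2) (.set 3 (.rel 4 2 3))))

def searchCM : RelProg :=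
  .each (.seq (.set 3 (.and (.rel 0 1 2) (.or (.rel 0 2 0) (.eq 2 0))))
    (.seq (.each saturateRound) (.set 2 (.or (.rel 2 1 2) (.rel 3 1 1)))))

/-- The program that fills relation `6` if the criterion is violated. -/
def search (c : Criterion) : RelProg :=
  .seq prepare (.seq (match c with
    | .CC => searchCC
    | .CM => searchCM
    | .CCv => searchCCv) conclude)

/-! ### What the search programs compute. -/

section Semantics

variable {X : Type u} {n : ℕ} {h : History (Fin n) RWMethod (RWData X)} {name : X → ℕ}
  {σ : RelStore n} {ρ : ℕ → Fin n}

theorem sem_prepare (hrw : h.IsRW) (hname : Set.InjOn name h.vars)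
    (hσ : ∀ m a b, ¬ σ m a b) :
    prepare.sem (h.table name) 0 ρ σ 0 = h.causal ∧
      (∀ a b, prepare.sem (h.table name) 0 ρ σ 2 a b ↔
        h.NeedsSource a ∧ ¬ ∃ w, h.ReadsFrom w a) ∧
      ∀ m > 2, ∀ a b, ¬ prepare.sem (h.table name) 0 ρ σ m a b := by
  have hrf := fun σ ρ => RelFormula.holds_readsFrom (σ := σ) (ρ := ρ) hrw hname
  have hns := fun σ ρ => RelFormula.holds_needsSource (σ := σ) (ρ := ρ) (name := name) hrw
  simp only [prepare, sem]
  rw [sem_transClose, sem_union (by simp [hrf])]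
  refine ⟨?_, ?_, fun m hm => ?_⟩
  · simp [RelFormula.Holds, hrf, Function.update, History.causal]
    rfl
  · simp [RelFormula.Holds, hrf, hns, Function.update, hσ]
  · have h₀ : m ≠ 0 := by omega
    have h₁ : m ≠ 1 := by omega
    have h₂ : m ≠ 2 := by omega
    simp [h₀, h₁, h₂, hσ]

theorem sem_conclude {D : OpTable n} (h₅ : ∀ a b, ¬ σ 5 a b) (h₆ : ∀ a b, ¬ σ 6 a b)
    (a b : Fin n) : conclude.sem D 0 ρ σ 6 a b ↔ ∃ i j, σ 2 i j := by
  simp only [conclude, sem]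
  rw [sem_union (by simp [RelFormula.Holds]), sem_union (by simp [RelFormula.Holds])]
  simp [RelFormula.Holds, Function.update, h₅, h₆]
  exact exists_comm

theorem sem_searchCC (hrw : h.IsRW) (hname : Set.InjOn name h.vars) (h₀ : σ 0 = h.causal) :
    (∀ m > 3, searchCC.sem (h.table name) 0 ρ σ m = σ m) ∧
    ((∃ a b, searchCC.sem (h.table name) 0 ρ σ 2 a b) ↔ (∃ a b, σ 2 a b) ∨
      (∃ a, h.causal a a) ∨ ∃ w₁ r w₂, h.Conflict w₁ r w₂ ∧ h.causal w₁ r ∧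
        (w₁ = w₂ ∨ h.causal w₂ w₁)) := by
  have hc := fun σ ρ => RelFormula.holds_conflict (σ := σ) (ρ := ρ) hrw hname
  simp only [searchCC, sem]
  rw [sem_union (by simp [RelFormula.Holds, hc])]
  refine ⟨fun m hm => ?_, ?_⟩
  · have h₂ : m ≠ 2 := by omega
    simp [h₂]
  · simp only [RelFormula.Holds, hc, Function.update, h₀]
    simp
    constructor
    · rintro ⟨a, b, (e | ⟨k, e⟩) | e⟩
      · exact .inl ⟨a, b, e⟩
      · exact .inr (.inr ⟨a, k, b, e⟩)
      · exact .inr (.inl ⟨a, e⟩)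
    · rintro (⟨a, b, e⟩ | ⟨a, e⟩ | ⟨a, k, b, e⟩)
      · exact ⟨a, b, .inl (.inl e)⟩
      · exact ⟨a, a, .inr e⟩
      · exact ⟨a, b, .inl (.inr ⟨k, e⟩)⟩

theorem sem_searchCCv (hrw : h.IsRW) (hname : Set.InjOn name h.vars) (h₀ : σ 0 = h.causal) :
    (∀ m > 3, searchCCv.sem (h.table name) 0 ρ σ m = σ m) ∧
    ((∃ a b, searchCCv.sem (h.table name) 0 ρ σ 2 a b) ↔ (∃ a b, σ 2 a b) ∨
      ∃ a, h.saturate Set.univ h.causal a a) := by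
  have hc := fun σ ρ => RelFormula.holds_conflict (σ := σ) (ρ := ρ) hrw hname
  simp only [searchCCv, sem]
  rw [sem_union (by simp [RelFormula.Holds, hc]), sem_transClose]
  refine ⟨fun m hm => ?_, ?_⟩
  · have h₂ : m ≠ 2 := by omega
    have h₃ : m ≠ 3 := by omega
    simp [h₂, h₃]
  · simp only [RelFormula.Holds, hc, Function.update, h₀]
    simp only [History.saturate, History.Forced, Set.mem_univ, true_and]
    simp
    constructor
    · rintro ⟨a, b, e | e⟩
      · exact .inl ⟨a, b, e⟩
      · exact .inr ⟨a, e⟩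
    · rintro (⟨a, b, e⟩ | ⟨a, e⟩)
      · exact ⟨a, b, .inl e⟩
      · exact ⟨a, a, .inr e⟩

/-- New edges are collected in relation `4` while relation `3` keeps the old order, so the forcing
within a round refers to one fixed order. -/
theorem sem_saturateRound (hrw : h.IsRW) (hname : Set.InjOn name h.vars) :
    (∀ m, m ≠ 3 → m ≠ 4 → saturateRound.sem (h.table name) 2 ρ σ m = σ m) ∧
      saturateRound.sem (h.table name) 2 ρ σ 3 = h.saturate (pastOf h.po (ρ 0)) (σ 3) := by
  have hc := fun σ ρ => RelFormula.holds_conflict (σ := σ) (ρ := ρ) hrw hname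
  simp only [saturateRound, sem]
  rw [sem_union (by simp [RelFormula.Holds, hc]), sem_transClose]
  refine ⟨fun m h₃ h₄ => by simp [h₃, h₄], ?_⟩
  simp only [RelFormula.Holds, hc, Function.update]
  simp only [History.saturate, History.Forced, pastOf, Set.mem_ofPred_eq]
  simp
  refine congrArg Relation.TransGen (funext₂ fun a b => propext (or_congr_right ⟨?_, ?_⟩))
  · rintro ⟨k, h₁, h₂, h₃ | rfl⟩
    · exact .inl ⟨k, h₃, h₁, h₂⟩
    · exact .inr ⟨h₁, h₂⟩
  · rintro (⟨k, h₃, h₁, h₂⟩ | ⟨h₁, h₂⟩)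
    · exact ⟨k, h₁, h₂, .inl h₃⟩
    · exact ⟨ρ 0, h₁, h₂, .inr rfl⟩

/-- Relations `3` and `4` are scratch, recomputed for each `o`; relation `2` accumulates the cycles
found. The inner loop variable only counts the `n` rounds. -/
theorem sem_searchCM (hrw : h.IsRW) (hname : Set.InjOn name h.vars) (h₀ : σ 0 = h.causal) :
    (∀ m > 4, searchCM.sem (h.table name) 0 ρ σ m = σ m) ∧
    ((∃ a b, searchCM.sem (h.table name) 0 ρ σ 2 a b) ↔ (∃ a b, σ 2 a b) ∨
      ∃ o a, ((h.saturate (pastOf h.po o))^[n] (h.causalTo o)) a a) := by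
  have key := iterFin_induction (n := n) (a := σ)
    (f := fun k σ => (RelProg.seq (.set 3 (.and (.rel 0 1 2) (.or (.rel 0 2 0) (.eq 2 0))))
      (.seq (.each saturateRound) (.set 2 (.or (.rel 2 1 2) (.rel 3 1 1))))).sem (h.table name) 1
        (Function.update ρ 0 k) σ)
    (fun l τ => (∀ m, m ≠ 2 → m ≠ 3 → m ≠ 4 → τ m = σ m) ∧ ∀ a b, τ 2 a b ↔ σ 2 a b ∨
      ∃ o : Fin n, o.val < l ∧ ((h.saturate (pastOf h.po o))^[n] (h.causalTo o)) a a)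
    ⟨fun _ _ _ _ => rfl, by simp⟩ (by
      rintro k τ ⟨h₁, h₂⟩
      simp only [sem]
      generalize hσ' : (Function.update τ 3 _ : RelStore n) = σ'
      have e₃ : σ' 3 = h.causalTo k := by
        rw [← hσ']
        funext a b
        simp [RelFormula.Holds, Function.update, h₁, h₀, History.causalTo, pastOf]
      have e₂ : ∀ m ≠ 3, σ' m = τ m := fun m hm => by rw [← hσ', Function.update_of_ne hm]
      obtain ⟨k₁, k₂⟩ := iterFin_induction (n := n) (a := σ')
        (f := fun t σ => saturateRound.sem (h.table name) (1 + 1)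
          (Function.update (Function.update ρ 0 k) 1 t) σ)
        (fun l τ => (∀ m, m ≠ 3 → m ≠ 4 → τ m = σ' m) ∧
          τ 3 = (h.saturate (pastOf h.po k))^[l] (h.causalTo k))
        ⟨fun _ _ _ => rfl, e₃⟩ (by
          rintro t υ ⟨h₁, h₂⟩
          obtain ⟨h₁', h₂'⟩ := sem_saturateRound hrw hname (name := name) (σ := υ)
            (ρ := Function.update (Function.update ρ 0 k) 1 t)
          refine ⟨fun m h₃ h₄ => (h₁' m h₃ h₄).trans (h₁ m h₃ h₄), h₂'.trans ?_⟩
          rw [Function.iterate_succ_apply', h₂]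
          simp [Function.update])
      generalize iterFin _ σ' n = υ at *
      refine ⟨fun m h₂ h₃ h₄ => ?_, fun a b => ?_⟩
      · rw [Function.update_of_ne h₂, k₁ m h₃ h₄, e₂ m h₃, h₁ m h₂ h₃ h₄]
      · simp only [Function.update_self, RelFormula.Holds, k₂, k₁ 2 (by omega) (by omega),
          e₂ 2 (by omega), h₂]
        simp [Function.update, or_assoc]
        simp [le_iff_lt_or_eq, or_and_right, exists_or])
  refine ⟨fun m hm => key.1 m (by omega) (by omega) (by omega), ?_⟩
  have key₂ := key.2
  simp only [Fin.is_lt, true_and] at key₂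
  simp only [searchCM, sem] at *
  simp only [key₂]
  constructor
  · rintro ⟨a, b, e | ⟨o, e⟩⟩
    · exact .inl ⟨a, b, e⟩
    · exact .inr ⟨o, a, e⟩
  · rintro (⟨a, b, e⟩ | ⟨o, a, e⟩)
    · exact ⟨a, b, .inl e⟩
    · exact ⟨a, a, .inr ⟨o, e⟩⟩

theorem sem_search (hrw : h.IsRW) (hd : h.Differentiated) (hname : Set.InjOn name h.vars)
    (hσ : ∀ m a b, ¬ σ m a b) (c : Criterion) (a b : Fin n) :
    (search c).sem (h.table name) 0 ρ σ 6 a b ↔ ¬ c.Holds h (rwMemory X) := by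
  obtain ⟨h₀, h₂, h₃⟩ := sem_prepare (ρ := ρ) hrw hname hσ
  simp only [search, sem]
  generalize prepare.sem (h.table name) 0 ρ σ = τ at *
  have hsrc : (∃ a b, τ 2 a b) ↔ ¬ h.HasSources := by
    simp only [h₂, History.HasSources, not_forall, exists_prop]
    exact ⟨fun ⟨r, _, e⟩ => ⟨r, e⟩, fun ⟨r, e⟩ => ⟨r, r, e⟩⟩
  have hfin : ∀ υ : RelStore n, (∀ m > 4, υ m = τ m) →
      (conclude.sem (h.table name) 0 ρ υ 6 a b ↔ ∃ i j, υ 2 i j) := fun υ hυ =>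
    sem_conclude (by rw [hυ 5 (by omega)]; exact h₃ 5 (by omega))
      (by rw [hυ 6 (by omega)]; exact h₃ 6 (by omega)) a b
  cases c with
  | CC =>
    obtain ⟨k₁, k₂⟩ := sem_searchCC (ρ := ρ) hrw hname h₀
    rw [hfin _ fun m hm => k₁ m (by omega), k₂, hsrc]
    simp only [Criterion.Holds]
    rw [isCC_iff hrw hd, not_and_or, not_and_or]
    simp only [not_forall, not_not, exists_prop]
  | CM =>
    obtain ⟨k₁, k₂⟩ := sem_searchCM (ρ := ρ) hrw hname h₀
    rw [hfin _ fun m hm => k₁ m (by omega), k₂, hsrc]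
    simp only [Criterion.Holds]
    rw [isCM_iff hrw hd, not_and_or]
    simp
  | CCv =>
    obtain ⟨k₁, k₂⟩ := sem_searchCCv (ρ := ρ) hrw hname h₀
    rw [hfin _ fun m hm => k₁ m (by omega), k₂, hsrc]
    simp only [Criterion.Holds]
    rw [isCCv_iff hrw hd, not_and_or]
    simp

end Semantics

theorem degree_search (c : Criterion) : (search c).degree = 5 ∨ (search c).degree = 3 := by
  cases c
  · exact .inr rfl
  · exact .inl rfl
  · exact .inr rfl

/-! ### The row table and the final random access program. -/

/-- Fill array `4` with the positions of the first entries of the rows of an `n × n` matrix. -/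
def rowTable : RamProg :=
  .forLoop 0 (.store 4 (.add (.reg 1) (.const 1)) (.add (.get 4 (.reg 1)) (.reg 0)))

theorem run_rowTable {n : ℕ} {reg : ℕ → ℕ} {a : ℕ → ℕ → ℕ} (h₀ : reg 0 = n) (h₁ : reg 1 = 0)
    (ha : a 4 0 = 0) : ∃ a' t, RamProg.Run rowTable ⟨reg, a⟩ ⟨reg, a'⟩ t ∧ t ≤ n * 16 + 6 ∧
      (∀ B ≠ 4, a' B = a B) ∧ ∀ i < n, a' 4 i = i * n := by
  obtain ⟨a', t, hr, ht, h₂, h₃⟩ := RamProg.run_forLoop (d := 0) (n := n) (T := 8) (reg := reg)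
    (a := a) (p := .store 4 (.add (.reg 1) (.const 1)) (.add (.get 4 (.reg 1)) (.reg 0)))
    (fun k a' => (∀ B ≠ 4, a' B = a B) ∧ ∀ i ≤ k, a' 4 i = i * n) h₀ h₁
    ⟨fun _ _ => rfl, fun i hi => by
      obtain rfl : i = 0 := by omega
      simp [ha]⟩ (by
      rintro k hk a₁ ⟨h₂, h₃⟩
      refine ⟨_, _, .store _ _ _ _, by simp [RamExpr.cost], fun B hB => ?_, fun i hi => ?_⟩
      · simp [hB, h₂ B hB]
      · simp only [RamExpr.eval, Function.update_self]
        by_cases e : i = k + 1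
        · subst e
          simp [h₃, h₀]
          ring
        · rw [Function.update_of_ne (by simpa using e)]
          exact h₃ i (by omega))
  exact ⟨a', t, hr, ht, h₂, fun i hi => h₃ i hi.le⟩

/-- The random access program that rejects if relation `6` holds for operation `0` after `p`. -/
def decider (p : RelProg) : RamProg :=
  .ite (.eq (.reg 0) (.const 0)) (.assign 0 (.const 1))
    (.seq rowTable (.seq (p.compile 0) (.assign 0 (.eq (.get 12 (.const 0)) (.const 0)))))

open Classical in
theorem run_decider (p : RelProg) : ∃ C, ∀ (X : Type u) (name : X → ℕ) (n : ℕ)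
    (h : History (Fin n) RWMethod (RWData X)), ∃ s t,
    RamProg.Run (decider p) (inputMemory name h) s t ∧ t ≤ C * n ^ p.degree + 16 * n + 20 ∧
      (n = 0 → s.reg 0 = 1) ∧ ∀ z : Fin n, z.val = 0 → s.reg 0 =
        if p.sem (h.table name) 0 (fun _ => z) (fun _ _ _ => False) 6 z z then 0 else 1 := by
  obtain ⟨C, hC⟩ := p.run_compile 0
  refine ⟨C, fun X name n h => ?_⟩
  rcases Nat.eq_zero_or_pos n with rfl | hn
  · refine ⟨_, _, .ite_true _ _ _ _ _ _ ?_ (.assign _ _ _), ?_, ?_, fun z => z.elim0⟩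
    · simp [RamExpr.eval, inputMemory]
    · simp [RamExpr.cost]
    · simp [RamExpr.eval]
  · obtain ⟨a₁, t₁, hr₁, ht₁, hB, hv⟩ := run_rowTable (n := n) (reg := (inputMemory name h).reg)
      (a := (inputMemory name h).arr) (by simp [inputMemory]) (by simp [inputMemory])
      (by simp [inputMemory])
    have harr : ArraysHold (h.table name) (fun _ _ _ => False) a₁ := by
      refine ⟨fun i => ?_, fun i j => ?_, fun m i j => ?_⟩
      · rw [hB 0 (by omega), hB 1 (by omega), hB 2 (by omega), hv i i.2]
        simp [inputMemory, History.table]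
      · rw [hB 3 (by omega)]
        have : (∃ i' j' : Fin n, i.val * n + j.val = i'.val * n + j'.val ∧ h.po i' j') ↔
            h.po i j := by
          constructor
          · rintro ⟨i', j', e, hp⟩
            obtain ⟨e₁, e₂⟩ := entry_inj j.2 j'.2 e
            rwa [Fin.ext e₁, Fin.ext e₂]
          · exact fun hp => ⟨i, j, rfl, hp⟩
        simp [inputMemory, History.table, this]
        congr
      · rw [hB (m + 6) (by omega)]
        simp [inputMemory]
    obtain ⟨a₂, t₂, hr₂, ht₂, ha₂⟩ := hC n (h.table name) (fun _ => ⟨0, hn⟩) _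
      (inputMemory name h).reg a₁
      (fun _ _ => rfl) ⟨by simp [inputMemory], by simp [inputMemory]⟩ harr
    refine ⟨_, _, .ite_false _ _ _ _ _ _ ?_ (.seq _ _ _ _ _ _ _ hr₁
      (.seq _ _ _ _ _ _ _ hr₂ (.assign _ _ _))), ?_, fun e => by omega, fun z hz => ?_⟩
    · simp [RamExpr.eval, inputMemory, hn.ne']
    · simp only [RamExpr.cost]
      omega
    · obtain rfl : z = ⟨0, hn⟩ := Fin.ext hz
      -- Relation `6` is stored in array `12`; being full or empty, it can be read off at entry `0`.
      have := ha₂.2.2 6 ⟨0, hn⟩ ⟨0, hn⟩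
      simp only [zero_mul, add_zero, Nat.reduceAdd] at this
      simp [RamExpr.eval, this]

end RelProg

theorem Criterion.holds_of_fin_zero {X : Type u} (c : Criterion)
    {h : History (Fin 0) RWMethod (RWData X)} (hrw : h.IsRW) (hd : h.Differentiated) :
    c.Holds h (rwMemory X) := by
  have hsrc : h.HasSources := fun r => r.elim0
  cases c with
  | CC => exact (isCC_iff hrw hd).2 ⟨hsrc, fun a => a.elim0, fun a => a.elim0⟩
  | CM => exact (isCM_iff hrw hd).2 ⟨hsrc, fun a => a.elim0⟩
  | CCv => exact (isCCv_iff hrw hd).2 ⟨hsrc, fun a => a.elim0⟩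

theorem mainTheorem7 (c : Criterion) :
    ∃ (P : RamProg) (T : ℕ → ℕ),
      Asymptotics.IsBigO Filter.atTop (fun n : ℕ => (T n : ℝ)) (fun n : ℕ => (n : ℝ) ^ 5) ∧
      ∀ (X : Type u) (name : X → ℕ) (n : ℕ) (h : History (Fin n) RWMethod (RWData X)),
        h.IsRW → h.Differentiated → Set.InjOn name h.vars →
        ∃ (s : MemState) (t : ℕ), RamProg.Run P (inputMemory name h) s t ∧ t ≤ T n ∧
          (c.Holds h (rwMemory X) → s.reg 0 = 1) ∧ (¬ c.Holds h (rwMemory X) → s.reg 0 = 0) := by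
  classical
  obtain ⟨C, hC⟩ := RelProg.run_decider.{u} (RelProg.search c)
  refine ⟨RelProg.decider (RelProg.search c),
    fun n => C * n ^ (RelProg.search c).degree + 16 * n + 20, ?_, ?_⟩
  · refine Asymptotics.IsBigO.of_bound (C + 36) ?_
    filter_upwards [Filter.eventually_ge_atTop 1] with n hn
    have h₁ : n ^ (RelProg.search c).degree ≤ n ^ 5 := by
      refine Nat.pow_le_pow_right hn ?_
      rcases RelProg.degree_search c with e | e <;> omega
    have h₂ : n ≤ n ^ 5 := Nat.le_self_pow (by omega) n
    have h₃ : C * n ^ (RelProg.search c).degree + 16 * n + 20 ≤ (C + 36) * n ^ 5 := by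
      have := Nat.mul_le_mul_left C h₁
      rw [add_mul]
      omega
    rw [Real.norm_of_nonneg (by positivity), Real.norm_of_nonneg (by positivity)]
    exact_mod_cast h₃
  · intro X name n h hrw hd hname
    obtain ⟨s, t, hr, ht, h₀, hs⟩ := hC X name n h
    refine ⟨s, t, hr, ht, ?_⟩
    -- Valuations of the relational language need an element of `Fin n`, so the empty history is
    -- treated apart; it satisfies all three criteria.
    rcases Nat.eq_zero_or_pos n with rfl | hn
    · have := c.holds_of_fin_zero hrw hd
      exact ⟨fun _ => h₀ rfl, fun e => (e this).elim⟩
    · rw [hs ⟨0, hn⟩ rfl]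
      simp only [RelProg.sem_search hrw hd hname (fun _ _ _ e => e) c]
      exact ⟨fun e => by simp [e], fun e => by simp [e]⟩
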